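/- **Theorem (uniform subsampling for a Kronecker product).** For every $C>0$ there is a constant $c_0>0$ such that for every $c\ge c_0$ there is a constant $K>0$ ($c_0$ depends only on $C$, and $K$ only on $C$ and $c$) for which the following holds. Let $n\ge 0$, $d\ge 2$, $A^1,A^2\in\mathbb R^{n\times d}$ and $\epsilon\in(0,1]$. Independently for $j=1,2$, carry out the following two steps. 1. Let $B_j$ be obtained from $A^j$ by keeping each row independently with probability $1/2$. For $i\in[n]$ let $a_i^\top$ be the $i$-th row of $A^j$ and let $$\sigma^{B_j}_i(A^j)=\begin{cases}a_i^\top (B_j^\top B_j)^\dagger a_i & \text{if } a_i\perp\ker B_j,\\ \infty&\text{otherwise,}\end{cases}\qquad p^j_i=\min\Big\{1,\ \frac{c\,\sigma^{B_j}_i(A^j)\log d}{\epsilon^{2}}\Big\},$$ where $\dagger$ denotes the Moore–Penrose pseudo-inverse. 2. Given $B_j$, let $\widetilde B^j$ be the matrix to which, independently for each $i\in[n]$, the row $a_i^\top/\sqrt{p^j_i}$ is added with probability $p^j_i$. Put $A=A^1\otimes A^2\in\mathbb R^{n^2\times d^2}$ and $\widetilde B=\widetilde B^1\otimes\widetilde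 B^2$. Then with probability at least $1-d^{-C}$ all of the following hold: 1. $(1-\epsilon)A^\top A\preceq \widetilde B^\top\widetilde B\preceq(1+\epsilon)A^\top A$; 2. $\widetilde B$ has at most $K\,\epsilon^{-4}d^2\log^2 d$ rows; 3. $\sum_{i=1}^n p^j_i\le K\,\epsilon^{-2}d\log d$ for $j=1,2$. -/

import Mathlib

open scoped ENNReal Matrix Kronecker

/-- The four Penrose equations: `P` is the Moore-Penrose pseudo-inverse of the real matrix `M`. -/
structure IsPseudoInverse {m k : Type*} [Fintype m] [Fintype k]
    (M : Matrix m k ℝ) (P : Matrix k m ℝ) : Prop where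
  mul_mul_self : M * P * M = M
  self_mul_mul : P * M * P = P
  left_symm : (M * P)ᵀ = M * P
  right_symm : (P * M)ᵀ = P * M

/-- The pseudo-inverse of a real symmetric matrix: keep an orthonormal eigenbasis and invert
the nonzero eigenvalues (in Lean `0⁻¹ = 0`). -/
noncomputable def symmPinv {k : Type*} [Fintype k] [DecidableEq k]
    {M : Matrix k k ℝ} (hM : M.IsHermitian) : Matrix k k ℝ :=
  (hM.eigenvectorUnitary : Matrix k k ℝ) * Matrix.diagonal (fun i => (hM.eigenvalues i)⁻¹) *
    (hM.eigenvectorUnitary : Matrix k k ℝ)ᵀ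

/-- `symmPinv` is the Moore-Penrose pseudo-inverse. -/
theorem symmPinv_isPseudoInverse {k : Type*} [Fintype k] [DecidableEq k]
    {M : Matrix k k ℝ} (hM : M.IsHermitian) : IsPseudoInverse M (symmPinv hM) := by
  obtain ⟨U, hU⟩ : ∃ U : Matrix k k ℝ, U = (hM.eigenvectorUnitary : Matrix k k ℝ) := ⟨_, rfl⟩
  have hUU : Uᵀ * U = 1 := by
    have h := Unitary.star_mul_self_of_mem hM.eigenvectorUnitary.2
    rw [← hU, Matrix.star_eq_conjTranspose, Matrix.conjTranspose_eq_transpose_of_trivial] at h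
    exact h
  have hspec : M = U * Matrix.diagonal hM.eigenvalues * Uᵀ := by
    have h := hM.spectral_theorem
    rw [Unitary.conjStarAlgAut_apply] at h
    simp only [← hU, Matrix.star_eq_conjTranspose,
      Matrix.conjTranspose_eq_transpose_of_trivial] at h
    exact h
  have key : ∀ f g : k → ℝ, (U * Matrix.diagonal f * Uᵀ) * (U * Matrix.diagonal g * Uᵀ) =
      U * Matrix.diagonal (fun i => f i * g i) * Uᵀ := by
    intro f g
    calc (U * Matrix.diagonal f * Uᵀ) * (U * Matrix.diagonal g * Uᵀ)
        = U * Matrix.diagonal f * (Uᵀ * U) * Matrix.diagonal g * Uᵀ := by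
          simp only [Matrix.mul_assoc]
      _ = _ := by
          rw [hUU, Matrix.mul_one, Matrix.mul_assoc U, Matrix.diagonal_mul_diagonal]
  have hsymm : ∀ f : k → ℝ, (U * Matrix.diagonal f * Uᵀ)ᵀ = U * Matrix.diagonal f * Uᵀ := by
    intro f
    simp [Matrix.transpose_mul, Matrix.mul_assoc]
  have hP : symmPinv hM = U * Matrix.diagonal (fun i => (hM.eigenvalues i)⁻¹) * Uᵀ := by
    rw [symmPinv, ← hU]
  obtain ⟨l, hl⟩ : ∃ l : k → ℝ, l = hM.eigenvalues := ⟨_, rfl⟩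
  rw [← hl] at hspec hP
  rw [hP]
  refine ⟨?_, ?_, ?_, ?_⟩
  · rw [hspec, key, key]
    simp only [mul_inv_mul_cancel]
  · rw [hspec, key, key]
    congr 3
    funext i
    simpa using mul_inv_mul_cancel (l i)⁻¹
  · rw [hspec, key, hsymm]
  · rw [hspec, key, hsymm]

/-- The generalized leverage score `σ^B(a)` of a row vector `a` with respect to a matrix `B`:
`aᵀ (Bᵀ B)† a` if `a` is orthogonal to the kernel of `B`, and `∞` otherwise (for a real matrix,
`Bᴴ = Bᵀ`). -/
noncomputable def genLeverage {m : Type*} [Fintype m] {d : ℕ}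
    (B : Matrix m (Fin d) ℝ) (a : Fin d → ℝ) : ℝ≥0∞ :=
  open Classical in
  if ∀ x : Fin d → ℝ, B *ᵥ x = 0 → a ⬝ᵥ x = 0 then
    ENNReal.ofReal (a ⬝ᵥ (symmPinv (Matrix.isHermitian_conjTranspose_mul_self B) *ᵥ a))
  else ⊤

/-- The law of a random set of row indices that contains each `i` independently with
probability `p i`. -/
noncomputable def indepSubset {n : ℕ} (p : Fin n → ℝ≥0∞) (hp : ∀ i, p i ≤ 1) :
    PMF (Finset (Fin n)) :=
  PMF.ofFintype (fun S => (∏ i ∈ S, p i) * ∏ i ∈ Finset.univ \ S, (1 - p i)) (by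
    have h := Finset.prod_add p (fun i => 1 - p i) Finset.univ
    rw [Finset.powerset_univ] at h
    rw [← h]
    exact Finset.prod_eq_one fun i _ => add_tsub_cancel_of_le (hp i))

/-- The submatrix of `A` that consists of the rows with index in `S`. -/
def keepRows {n d : ℕ} (A : Matrix (Fin n) (Fin d) ℝ) (S : Finset (Fin n)) :
    Matrix S (Fin d) ℝ :=
  Matrix.of fun i => A i

/-- The matrix whose rows are the `A i / √(p i)` for `i ∈ T`. -/
noncomputable def rescaledRows {n d : ℕ} (A : Matrix (Fin n) (Fin d) ℝ) (p : Fin n → ℝ≥0∞)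
    (T : Finset (Fin n)) : Matrix T (Fin d) ℝ :=
  Matrix.of fun i => (1 / Real.sqrt (p i).toReal) • A i

/-- The sampling probabilities `p i = min {1, c * w i * log d / ε²}` with the weights
`w i = σ^B_i(A)`, where `B` consists of the rows of `A` with index in `S`. -/
noncomputable def sampleProb {n d : ℕ} (c ε : ℝ) (A : Matrix (Fin n) (Fin d) ℝ)
    (S : Finset (Fin n)) (i : Fin n) : ℝ≥0∞ :=
  min 1 (ENNReal.ofReal (c * Real.log d / ε ^ 2) * genLeverage (keepRows A S) (A i))

/-- The law of the pair `(S, T)` for one matrix `A`: `S` keeps each row index independently with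
probability `1/2`, and then, given `S`, the set `T` contains each row index `i` independently
with probability `sampleProb c ε A S i`. -/
noncomputable def sampleLaw {n d : ℕ} (c ε : ℝ) (A : Matrix (Fin n) (Fin d) ℝ) :
    PMF (Finset (Fin n) × Finset (Fin n)) :=
  (indepSubset (fun _ => 1 / 2) (fun _ => by simp)).bind fun S =>
    (indepSubset (sampleProb c ε A S) (fun _ => min_le_left _ _)).map fun T => (S, T)

/-- The joint law of two independent samples, one for `A₁` and one for `A₂`. -/
noncomputable def sampleLaw₂ {n d : ℕ} (c ε : ℝ) (A₁ A₂ : Matrix (Fin n) (Fin d) ℝ) :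
    PMF ((Finset (Fin n) × Finset (Fin n)) × (Finset (Fin n) × Finset (Fin n))) :=
  (sampleLaw c ε A₁).bind fun ω₁ => (sampleLaw c ε A₂).map fun ω₂ => (ω₁, ω₂)

/-- The weighted sample `B̃` of `A` that belongs to the outcome `ω = (S, T)`. -/
noncomputable def weightedSample {n d : ℕ} (c ε : ℝ) (A : Matrix (Fin n) (Fin d) ℝ)
    (ω : Finset (Fin n) × Finset (Fin n)) : Matrix ω.2 (Fin d) ℝ :=
  rescaledRows A (sampleProb c ε A ω.1) ω.2

/-- `(1 - ε) H ⪯ G ⪯ (1 + ε) H` in the Loewner order. -/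
def SpectralApprox {k : Type*} (ε : ℝ) (G H : Matrix k k ℝ) : Prop :=
  (G - (1 - ε) • H).PosSemidef ∧ ((1 + ε) • H - G).PosSemidef

/-- The number of rows of a matrix. -/
def numRows {m k : Type*} [Fintype m] (_ : Matrix m k ℝ) : ℕ := Fintype.card m

/-! For one factor, write q(x) for the sum of the squares (a_i·x)² over all rows. Three events are
shown to be likely: the weighted sample has quadratic form within a factor 1 ± ε/3 of q, it has few
rows, and the probabilities have a small sum. The Kronecker product of two such approximations has
error at most 2(ε/3) + (ε/3)² ≤ ε, and row counts multiply.

Accuracy. A score computed from a subset of the rows can only overestimate the share of a row in q,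
so a row with p_i < 1 satisfies (a_i·x)²/p_i ≤ R·q(x) with R = ε²/(c log d). This is the hypothesis
of a matrix Chernoff bound (`Matrix.matrix_chernoff`) with failure probability d·exp(-Ω(1/R)) at
constant relative error and d·exp(-Ω(ε²/R)) at relative error ε/3.

Size. Some rows may have large scores because of the uniform subsampling. An extremal reweighting
(`exists_reweighting`) lowers the weights of only O(d log d) rows and makes every weighted row
light. Chernoff then shows that half of the rows dominate, up to a factor 4, the set G of unchanged
rows (`exists_dominated_rows`). Scores over G then sum to at most 4d (`sum_genLeverage_le`), and
each row outside G is charged probability 1.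

The Chernoff bound is proved without Lieb's concavity theorem. For a Bernoulli summand,
Golden-Thompson moves the random term out of the exponent, a chord bound linearizes its exponential,
and Klein's inequality moves the resulting mean back in (`Matrix.bernoulli_trace_exp_le`). Nothing
is lost between successive summands, so the bound iterates. Forms may be singular, so a ridge term
r|x|² makes them invertible; `exists_ridge` removes it because only finitely many outcomes occur. -/

/-! ### Trace inequalities for powers of products -/

namespace Matrix

variable {k : Type*} [Fintype k] [DecidableEq k]

theorem trace_mul_pow_comm (X Y : Matrix k k ℝ) (m : ℕ) :
    ((X * Y) ^ m).trace = ((Y * X) ^ m).trace := by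
  cases m with
  | zero => simp
  | succ m =>
    have h : X * (Y * X) ^ m = (X * Y) ^ m * X :=
      SemiconjBy.pow_right (show SemiconjBy X (Y * X) (X * Y) by
        simp [SemiconjBy, Matrix.mul_assoc]) m
    rw [pow_succ, ← Matrix.mul_assoc, ← h, Matrix.mul_assoc, trace_mul_comm, Matrix.mul_assoc,
      pow_succ]

theorem trace_mul_transpose_self_nonneg {k : Type*} [Fintype k] (Z : Matrix k k ℝ) :
    0 ≤ (Z * Zᵀ).trace := by
  simp only [trace, diag_apply, mul_apply, transpose_apply]
  exact Finset.sum_nonneg fun i _ => Finset.sum_nonneg fun j _ => mul_self_nonneg _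

theorem trace_mul_self_le {k : Type*} [Fintype k] (Z : Matrix k k ℝ) :
    (Z * Z).trace ≤ (Z * Zᵀ).trace := by
  have h := trace_mul_transpose_self_nonneg (Z - Zᵀ)
  have h1 : (Zᵀ * Z).trace = (Z * Zᵀ).trace := trace_mul_comm _ _
  have h2 : (Zᵀ * Zᵀ).trace = (Z * Z).trace := by
    rw [← transpose_mul, trace_transpose]
  simp only [transpose_sub, transpose_transpose, Matrix.sub_mul, Matrix.mul_sub, trace_sub] at h
  linarith

theorem two_mul_trace_mul_le {k : Type*} [Fintype k] {X Y : Matrix k k ℝ} (hX : X.IsSymm)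
    (hY : Y.IsSymm) :
    2 * (X * Y).trace ≤ (X * X).trace + (Y * Y).trace := by
  have h := trace_mul_transpose_self_nonneg (X - Y)
  have h1 : (Y * X).trace = (X * Y).trace := trace_mul_comm _ _
  simp only [transpose_sub, hX.eq, hY.eq, Matrix.sub_mul, Matrix.mul_sub, trace_sub] at h
  linarith

/-- The two claims feed each other in one induction. The first at j + 1 applies the first at j to
Z², cycles the trace to ZᵀZ·ZZᵀ, and then uses the second and the inequality 2 tr(XY) ≤ tr X² + tr
Y². The second at j + 1 applies the first to XY and cycles XYYX to Y²X². Powers of two suffice for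
the limit in Golden-Thompson. -/
theorem trace_pow_two_pow_le (j : ℕ) :
    (∀ Z : Matrix k k ℝ, (Z ^ 2 ^ (j + 1)).trace ≤ ((Z * Zᵀ) ^ 2 ^ j).trace) ∧
    ∀ X Y : Matrix k k ℝ, X.IsSymm → Y.IsSymm →
      ((X * Y) ^ 2 ^ j).trace ≤ (X ^ 2 ^ j * Y ^ 2 ^ j).trace := by
  induction j with
  | zero =>
    refine ⟨fun Z => ?_, fun X Y _ _ => by simp⟩
    simpa [pow_two] using trace_mul_self_le Z
  | succ j ih =>
    obtain ⟨ihP, ihQ⟩ := ih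
    refine ⟨fun Z => ?_, fun X Y hX hY => ?_⟩
    · have h1 := ihP (Z * Z)
      have h2 := ihQ (Zᵀ * Z) (Z * Zᵀ) (by simp [IsSymm]) (by simp [IsSymm])
      have h3 := two_mul_trace_mul_le (X := (Zᵀ * Z) ^ 2 ^ j) (Y := (Z * Zᵀ) ^ 2 ^ j)
        (by simp [IsSymm, transpose_pow]) (by simp [IsSymm, transpose_pow])
      have h4 : ((Z * Z * (Z * Z)ᵀ) ^ 2 ^ j).trace = ((Zᵀ * Z * (Z * Zᵀ)) ^ 2 ^ j).trace := by
        have := trace_mul_pow_comm (Z * (Z * Zᵀ)) Zᵀ (2 ^ j)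
        simpa only [transpose_mul, Matrix.mul_assoc] using this
      have h5 := trace_mul_pow_comm Z Zᵀ (2 ^ (j + 1))
      rw [← pow_add, ← pow_add, ← two_mul, ← pow_succ'] at h3
      rw [← pow_two Z, ← pow_mul, ← pow_succ', pow_two Z] at h1
      linarith
    · have h1 := ihP (X * Y)
      have h2 := ihQ (Y ^ 2) (X ^ 2) (by simp [IsSymm, transpose_pow, hY.eq])
        (by simp [IsSymm, transpose_pow, hX.eq])
      have h3 : ((X * Y * (X * Y)ᵀ) ^ 2 ^ j).trace = ((Y ^ 2 * X ^ 2) ^ 2 ^ j).trace := by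
        have := trace_mul_pow_comm X (Y * (Y * X)) (2 ^ j)
        simpa only [transpose_mul, hX.eq, hY.eq, Matrix.mul_assoc, pow_two] using this
      rw [← pow_mul, ← pow_mul, ← pow_succ', trace_mul_comm] at h2
      linarith

end Matrix

/-! ### The Lie product formula -/

section LieProduct

open NormedSpace Filter Topology

theorem norm_pow_sub_pow_le {𝔸 : Type*} [NormedRing 𝔸] [NormOneClass 𝔸] {x y : 𝔸} {M : ℝ}
    (hM : 1 ≤ M) (hx : ‖x‖ ≤ M) (hy : ‖y‖ ≤ M) (n : ℕ) :
    ‖x ^ n - y ^ n‖ ≤ n * ‖x - y‖ * M ^ n := by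
  have hM0 : 0 ≤ M := zero_le_one.trans hM
  induction n with
  | zero => simp
  | succ n ih =>
    have e : x ^ (n + 1) - y ^ (n + 1) = x ^ n * (x - y) + (x ^ n - y ^ n) * y := by
      rw [pow_succ, pow_succ]; noncomm_ring
    have hxn : ‖x ^ n‖ ≤ M ^ n := (norm_pow_le x n).trans (pow_le_pow_left₀ (norm_nonneg _) hx n)
    have h1 : M ^ n ≤ M ^ (n + 1) := pow_le_pow_right₀ hM n.le_succ
    calc ‖x ^ (n + 1) - y ^ (n + 1)‖ ≤ ‖x ^ n‖ * ‖x - y‖ + ‖x ^ n - y ^ n‖ * ‖y‖ := by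
          rw [e]
          exact (norm_add_le _ _).trans (add_le_add (norm_mul_le _ _) (norm_mul_le _ _))
      _ ≤ M ^ (n + 1) * ‖x - y‖ + (n * ‖x - y‖ * M ^ n) * M := by
          gcongr
          exact hxn.trans h1
      _ = _ := by push_cast; ring

theorem norm_exp_le_exp_norm {𝔸 : Type*} [NormedRing 𝔸] [NormedAlgebra ℝ 𝔸] [NormOneClass 𝔸]
    [CompleteSpace 𝔸] (x : 𝔸) : ‖exp x‖ ≤ Real.exp ‖x‖ := by
  have hs : Summable fun n : ℕ => ‖x‖ ^ n / (n.factorial : ℝ) := Real.summable_pow_div_factorial _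
  have hle : ∀ n : ℕ, ‖((n.factorial : ℝ)⁻¹) • x ^ n‖ ≤ ‖x‖ ^ n / (n.factorial : ℝ) := by
    intro n
    rw [norm_smul, norm_inv, RCLike.norm_natCast, div_eq_inv_mul]
    exact mul_le_mul_of_nonneg_left (norm_pow_le _ _) (by positivity)
  rw [congrFun (exp_eq_tsum ℝ) x, Real.exp_eq_exp_ℝ, congrFun exp_eq_tsum_div ‖x‖]
  exact tsum_of_norm_bounded hs.hasSum hle

/-- The **Lie product formula**. -/
theorem tendsto_exp_mul_exp_pow {𝔸 : Type*} [NormedRing 𝔸] [NormedAlgebra ℝ 𝔸] [NormOneClass 𝔸]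
    [CompleteSpace 𝔸] (a b : 𝔸) :
    Tendsto (fun n : ℕ => (exp ((n : ℝ)⁻¹ • a) * exp ((n : ℝ)⁻¹ • b)) ^ n) atTop
      (𝓝 (exp (a + b))) := by
  let _ : NormedAlgebra ℚ 𝔸 := NormedAlgebra.restrictScalars ℚ ℝ 𝔸
  -- The two curves agree to first order at 0, so their difference at 1/n is o(1/n). This beats the
  -- factor n lost in comparing n-th powers.
  have hd : HasDerivAt (fun t : ℝ => exp (t • a) * exp (t • b) - exp (t • (a + b))) 0 0 := by
    have h := ((hasDerivAt_exp_smul_const (𝕂 := ℝ) a 0).mul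
      (hasDerivAt_exp_smul_const (𝕂 := ℝ) b 0)).sub (hasDerivAt_exp_smul_const (𝕂 := ℝ) (a + b) 0)
    refine h.congr_deriv ?_
    simp
  have hinv : Tendsto (fun n : ℕ => (n : ℝ)⁻¹) atTop (𝓝[≠] 0) := by
    refine tendsto_nhdsWithin_iff.2 ⟨tendsto_inv_atTop_nhds_zero_nat, ?_⟩
    filter_upwards [eventually_gt_atTop 0] with n hn
    have : (0 : ℝ) < n := by exact_mod_cast hn
    simpa using this.ne'
  have hs := (hasDerivAt_iff_tendsto_slope.1 hd).comp hinv
  have hs' := hs.norm.mul_const (Real.exp (‖a‖ + ‖b‖))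
  rw [norm_zero, zero_mul] at hs'
  refine tendsto_iff_norm_sub_tendsto_zero.2 (squeeze_zero' (Eventually.of_forall fun _ =>
    norm_nonneg _) ?_ hs')
  filter_upwards [eventually_gt_atTop 0] with n hn
  have hn0 : (0 : ℝ) < n := by exact_mod_cast hn
  have hexp : ∀ c : 𝔸, ‖exp ((n : ℝ)⁻¹ • c)‖ ≤ Real.exp ((n : ℝ)⁻¹ * ‖c‖) := by
    intro c
    refine (norm_exp_le_exp_norm _).trans (le_of_eq ?_)
    rw [norm_smul, Real.norm_of_nonneg (inv_nonneg.2 hn0.le)]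
  have hy : exp (a + b) = exp ((n : ℝ)⁻¹ • (a + b)) ^ n := by
    rw [← exp_nsmul, ← Nat.cast_smul_eq_nsmul ℝ, smul_smul, mul_inv_cancel₀ hn0.ne', one_smul]
  have hM : Real.exp ((n : ℝ)⁻¹ * (‖a‖ + ‖b‖)) ^ n = Real.exp (‖a‖ + ‖b‖) := by
    rw [← Real.exp_nat_mul, ← mul_assoc, mul_inv_cancel₀ hn0.ne', one_mul]
  have key := norm_pow_sub_pow_le (x := exp ((n : ℝ)⁻¹ • a) * exp ((n : ℝ)⁻¹ • b))
    (y := exp ((n : ℝ)⁻¹ • (a + b))) (M := Real.exp ((n : ℝ)⁻¹ * (‖a‖ + ‖b‖)))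
    (Real.one_le_exp (by positivity))
    ((norm_mul_le _ _).trans (by
      rw [mul_add, Real.exp_add]
      exact mul_le_mul (hexp a) (hexp b) (norm_nonneg _) (Real.exp_pos _).le))
    ((hexp _).trans (Real.exp_le_exp.2 (by gcongr; exact norm_add_le _ _))) n
  rw [← hy, hM] at key
  refine key.trans (le_of_eq ?_)
  congr 1
  simp [slope_def_module, norm_smul]

end LieProduct

/-! ### Golden-Thompson and Klein inequalities -/

namespace Matrix

open NormedSpace Filter Topology

variable {k : Type*} [Fintype k] [DecidableEq k]

open scoped Norms.Operator in
/-- The **Golden-Thompson inequality** for real symmetric matrices. -/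
theorem trace_exp_add_le [Nonempty k] {A B : Matrix k k ℝ} (hA : A.IsSymm)
    (hB : B.IsSymm) : (exp (A + B)).trace ≤ (exp A * exp B).trace := by
  -- The Lie formula is taken along exponents 2^j, where the trace inequality for powers bounds
  -- every term by the same right-hand side.
  have h1 : Tendsto (fun j : ℕ => ((exp (((2 ^ j : ℕ) : ℝ)⁻¹ • A) *
      exp (((2 ^ j : ℕ) : ℝ)⁻¹ • B)) ^ 2 ^ j).trace) atTop (𝓝 (exp (A + B)).trace) := by
    have hc : Continuous fun M : Matrix k k ℝ => M.trace := continuous_id.matrix_trace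
    exact (hc.tendsto _).comp ((tendsto_exp_mul_exp_pow A B).comp
      (tendsto_pow_atTop_atTop_of_one_lt one_lt_two))
  refine le_of_tendsto' h1 fun j => ?_
  have hpow : ∀ M : Matrix k k ℝ, exp (((2 ^ j : ℕ) : ℝ)⁻¹ • M) ^ 2 ^ j = exp M := by
    intro M
    rw [← Matrix.exp_nsmul, ← Nat.cast_smul_eq_nsmul ℝ, smul_smul, mul_inv_cancel₀, one_smul]
    positivity
  have := (trace_pow_two_pow_le j).2 (exp (((2 ^ j : ℕ) : ℝ)⁻¹ • A))
    (exp (((2 ^ j : ℕ) : ℝ)⁻¹ • B)) (IsSymm.exp (by simp [IsSymm, hA.eq]))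
    (IsSymm.exp (by simp [IsSymm, hB.eq]))
  rwa [hpow, hpow] at this

theorem exists_diagonalization {H : Matrix k k ℝ} (hH : H.IsSymm) :
    ∃ (U : Matrix k k ℝ) (l : k → ℝ), Uᵀ * U = 1 ∧ U * Uᵀ = 1 ∧ H = U * diagonal l * Uᵀ := by
  have hH' : H.IsHermitian := by
    rw [IsHermitian, conjTranspose_eq_transpose_of_trivial]; exact hH
  have h1 := Unitary.star_mul_self_of_mem hH'.eigenvectorUnitary.2
  have h2 := Unitary.mul_star_self_of_mem hH'.eigenvectorUnitary.2
  have h := hH'.spectral_theorem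
  rw [Unitary.conjStarAlgAut_apply] at h
  simp only [star_eq_conjTranspose, conjTranspose_eq_transpose_of_trivial] at h h1 h2
  exact ⟨_, _, h1, h2, h⟩

theorem exp_mul_diagonal_mul_transpose {U : Matrix k k ℝ} (hU : Uᵀ * U = 1) (l : k → ℝ) :
    exp (U * diagonal l * Uᵀ) = U * diagonal (fun i => Real.exp (l i)) * Uᵀ := by
  have hinv : U⁻¹ = Uᵀ := inv_eq_left_inv hU
  have hunit : IsUnit U := IsUnit.of_mul_eq_one Uᵀ (mul_eq_one_comm.1 hU)
  rw [← hinv, exp_conj U _ hunit, exp_diagonal]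
  congr 3
  funext i
  simp [Real.exp_eq_exp_ℝ]

/-- The weights (UᵀW)ᵢⱼ² are nonnegative, so a scalar inequality between pairs of eigenvalues passes
to traces of products even when the matrices do not commute. -/
theorem trace_mul_diagonal_mul_diagonal (U W : Matrix k k ℝ) (f g : k → ℝ) :
    ((U * diagonal f * Uᵀ) * (W * diagonal g * Wᵀ)).trace =
      ∑ i, ∑ j, f i * g j * (Uᵀ * W) i j ^ 2 := by
  have h : ((U * diagonal f * Uᵀ) * (W * diagonal g * Wᵀ)).trace =
      ((diagonal f * (Uᵀ * W)) * (diagonal g * (Uᵀ * W)ᵀ)).trace := by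
    rw [transpose_mul, transpose_transpose, Matrix.mul_assoc U, Matrix.mul_assoc U,
      trace_mul_comm U]
    simp only [Matrix.mul_assoc]
  rw [h]
  simp only [trace, diag_apply, mul_apply (M := diagonal f * (Uᵀ * W)), diagonal_mul,
    transpose_apply]
  exact Finset.sum_congr rfl fun i _ => Finset.sum_congr rfl fun j _ => by ring

/-- **Klein's inequality** for the exponential. -/
theorem trace_exp_add_trace_exp_mul_le {H Y : Matrix k k ℝ} (hH : H.IsSymm)
    (hY : Y.IsSymm) : (exp H).trace + (exp H * Y).trace ≤ (exp (H + Y)).trace := by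
  obtain ⟨U, l, hU, hU', hHe⟩ := exists_diagonalization hH
  obtain ⟨W, m, hW, hW', hKe⟩ := exists_diagonalization (hH.add hY)
  have e1 : (exp (H + Y)).trace = ∑ i, ∑ j, 1 * Real.exp (m j) * (Uᵀ * W) i j ^ 2 := by
    rw [← trace_mul_diagonal_mul_diagonal U W (fun _ => 1), hKe,
      exp_mul_diagonal_mul_transpose hW, diagonal_one, Matrix.mul_one, hU', Matrix.one_mul]
  have hone : W * diagonal (fun _ => 1) * Wᵀ = 1 := by
    rw [diagonal_one, Matrix.mul_one, hW']
  have e2 : (exp H).trace = ∑ i, ∑ j, Real.exp (l i) * 1 * (Uᵀ * W) i j ^ 2 := by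
    rw [← trace_mul_diagonal_mul_diagonal U W _ (fun _ => 1), hone, hHe,
      exp_mul_diagonal_mul_transpose hU, Matrix.mul_one]
  have e3 : (exp H * (H + Y)).trace = ∑ i, ∑ j, Real.exp (l i) * m j * (Uᵀ * W) i j ^ 2 := by
    rw [← trace_mul_diagonal_mul_diagonal U W, ← exp_mul_diagonal_mul_transpose hU, ← hHe, ← hKe]
  have e4 : (exp H * H).trace = ∑ i, ∑ j, (Real.exp (l i) * l i) * 1 * (Uᵀ * W) i j ^ 2 := by
    rw [← trace_mul_diagonal_mul_diagonal U W _ (fun _ => 1), hone, Matrix.mul_one]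
    conv_lhs => rw [hHe, exp_mul_diagonal_mul_transpose hU]
    rw [show U * diagonal (fun i => Real.exp (l i)) * Uᵀ * (U * diagonal l * Uᵀ) =
      U * diagonal (fun i => Real.exp (l i)) * (Uᵀ * U) * diagonal l * Uᵀ by
        simp only [Matrix.mul_assoc], hU, Matrix.mul_one, Matrix.mul_assoc U (diagonal _),
      diagonal_mul_diagonal]
  rw [Matrix.mul_add, trace_add] at e3
  have key : (exp H).trace + ((exp H * H).trace + (exp H * Y).trace) - (exp H * H).trace ≤
      (exp (H + Y)).trace := by
    rw [e3, e4, e2, e1, ← Finset.sum_add_distrib, ← Finset.sum_sub_distrib]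
    refine Finset.sum_le_sum fun i _ => ?_
    rw [← Finset.sum_add_distrib, ← Finset.sum_sub_distrib]
    refine Finset.sum_le_sum fun j _ => ?_
    -- The scalar case: the exponential lies above its tangent at `l i`.
    have h : Real.exp (l i) * (m j - l i + 1) ≤ Real.exp (m j) := by
      calc _ ≤ Real.exp (l i) * Real.exp (m j - l i) :=
            mul_le_mul_of_nonneg_left (Real.add_one_le_exp _) (Real.exp_pos _).le
        _ = _ := by rw [← Real.exp_add]; congr 1; ring
    nlinarith [sq_nonneg ((Uᵀ * W) i j)]
  linarith

end Matrix

/-! ### Trace exponentials: eigenvalue bounds and the Bernoulli step -/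

namespace Matrix

open NormedSpace

variable {k : Type*} [Fintype k] [DecidableEq k]

theorem dotProduct_mulVec_diagonalization (U : Matrix k k ℝ) (l x : k → ℝ) :
    x ⬝ᵥ ((U * diagonal l * Uᵀ) *ᵥ x) = ∑ j, l j * (Uᵀ *ᵥ x) j ^ 2 := by
  rw [← mulVec_mulVec, ← mulVec_mulVec, dotProduct_mulVec, ← mulVec_transpose]
  simp only [dotProduct, mulVec_diagonal]
  exact Finset.sum_congr rfl fun j _ => by ring

theorem dotProduct_self_eq_sum_of_mul_transpose {U : Matrix k k ℝ} (hU : U * Uᵀ = 1)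
    (x : k → ℝ) : x ⬝ᵥ x = ∑ j, (Uᵀ *ᵥ x) j ^ 2 := by
  have h := dotProduct_mulVec_diagonalization U (fun _ => 1) x
  rw [diagonal_one, Matrix.mul_one, hU, one_mulVec] at h
  simpa using h

theorem exists_dotProduct_mulVec_eq {U : Matrix k k ℝ} (hU : Uᵀ * U = 1) (l : k → ℝ) (j : k) :
    ∃ x : k → ℝ, x ⬝ᵥ x = 1 ∧ x ⬝ᵥ ((U * diagonal l * Uᵀ) *ᵥ x) = l j := by
  have hx : Uᵀ *ᵥ (U *ᵥ Pi.single j 1) = Pi.single j 1 := by rw [mulVec_mulVec, hU, one_mulVec]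
  refine ⟨U *ᵥ Pi.single j 1, ?_, ?_⟩
  · rw [dotProduct_self_eq_sum_of_mul_transpose (mul_eq_one_comm.1 hU), hx]
    simp [Pi.single_apply]
  · rw [dotProduct_mulVec_diagonalization, hx]
    simp [Pi.single_apply]

theorem trace_exp_le_card_mul_exp {K : Matrix k k ℝ} (hK : K.IsSymm) {κ : ℝ}
    (h : ∀ x : k → ℝ, x ⬝ᵥ (K *ᵥ x) ≤ κ * (x ⬝ᵥ x)) :
    (exp K).trace ≤ Fintype.card k * Real.exp κ := by
  obtain ⟨U, l, hU, hU', rfl⟩ := exists_diagonalization hK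
  have hl : ∀ j, l j ≤ κ := by
    intro j
    obtain ⟨x, hx1, hx2⟩ := exists_dotProduct_mulVec_eq hU l j
    have := h x
    rwa [hx1, hx2, mul_one] at this
  rw [exp_mul_diagonal_mul_transpose hU, trace_mul_comm, ← Matrix.mul_assoc, hU, Matrix.one_mul,
    trace_diagonal]
  calc ∑ i, Real.exp (l i) ≤ ∑ _i : k, Real.exp κ :=
        Finset.sum_le_sum fun i _ => Real.exp_le_exp.2 (hl i)
    _ = _ := by simp

theorem trace_exp_nonneg {K : Matrix k k ℝ} (hK : K.IsSymm) : 0 ≤ (exp K).trace := by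
  obtain ⟨U, l, hU, hU', rfl⟩ := exists_diagonalization hK
  rw [exp_mul_diagonal_mul_transpose hU, trace_mul_comm, ← Matrix.mul_assoc, hU, Matrix.one_mul,
    trace_diagonal]
  exact Finset.sum_nonneg fun i _ => (Real.exp_pos _).le

theorem exp_le_trace_exp {K : Matrix k k ℝ} (hK : K.IsSymm) {κ : ℝ} {x : k → ℝ}
    (h : κ * (x ⬝ᵥ x) < x ⬝ᵥ (K *ᵥ x)) : Real.exp κ ≤ (exp K).trace := by
  obtain ⟨U, l, hU, hU', rfl⟩ := exists_diagonalization hK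
  have hl : ∃ j, κ < l j := by
    by_contra! hcon
    refine absurd h (not_lt.2 ?_)
    rw [dotProduct_mulVec_diagonalization, dotProduct_self_eq_sum_of_mul_transpose hU',
      Finset.mul_sum]
    exact Finset.sum_le_sum fun j _ => mul_le_mul_of_nonneg_right (hcon j) (sq_nonneg _)
  obtain ⟨j, hj⟩ := hl
  rw [exp_mul_diagonal_mul_transpose hU, trace_mul_comm, ← Matrix.mul_assoc, hU, Matrix.one_mul,
    trace_diagonal]
  exact (Real.exp_le_exp.2 hj.le).trans
    (Finset.single_le_sum (f := fun i => Real.exp (l i)) (fun i _ => (Real.exp_pos _).le)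
      (Finset.mem_univ j))

theorem exp_mul_le_one_add_chord {l R : ℝ} (t : ℝ) (hR : 0 < R) (h0 : 0 ≤ l) (h1 : l ≤ R) :
    Real.exp (t * l) ≤ 1 + (Real.exp (t * R) - 1) / R * l := by
  have ha : 0 ≤ 1 - l / R := by rw [sub_nonneg, div_le_one hR]; exact h1
  have hb : 0 ≤ l / R := by positivity
  have h := convexOn_exp.2 (Set.mem_univ 0) (Set.mem_univ (t * R)) ha hb (by ring)
  simp only [smul_eq_mul, mul_zero, zero_add, Real.exp_zero, mul_one] at h
  have e : l / R * (t * R) = t * l := by field_simp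
  rw [e] at h
  refine h.trans (le_of_eq ?_)
  ring

/-- The spectrum of Y lies in [0, R], where convexity puts exp(t·) below its chord. Linearity in Y
is what permits averaging over a Bernoulli variable. -/
theorem trace_exp_mul_exp_smul_le {H Y : Matrix k k ℝ} (hH : H.IsSymm) (hY : Y.IsSymm) {R : ℝ}
    (hR : 0 < R) (h0 : ∀ x : k → ℝ, 0 ≤ x ⬝ᵥ (Y *ᵥ x))
    (h1 : ∀ x : k → ℝ, x ⬝ᵥ (Y *ᵥ x) ≤ R * (x ⬝ᵥ x)) (t : ℝ) :
    (exp H * exp (t • Y)).trace ≤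
      (exp H).trace + (exp H * (((Real.exp (t * R) - 1) / R) • Y)).trace := by
  obtain ⟨g, hg⟩ : ∃ g, g = (Real.exp (t * R) - 1) / R := ⟨_, rfl⟩
  obtain ⟨W, m, hW, hW', rfl⟩ := exists_diagonalization hH
  obtain ⟨U, l, hU, hU', rfl⟩ := exists_diagonalization hY
  have hl : ∀ j, 0 ≤ l j ∧ l j ≤ R := by
    intro j
    obtain ⟨x, hx1, hx2⟩ := exists_dotProduct_mulVec_eq hU l j
    have h0' := h0 x
    have h1' := h1 x
    rw [hx2] at h0' h1'
    rw [hx1, mul_one] at h1'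
    exact ⟨h0', h1'⟩
  have hsm : ∀ a : ℝ, a • (U * diagonal l * Uᵀ) = U * diagonal (fun j => a * l j) * Uᵀ := by
    intro a
    have : diagonal (fun j => a * l j) = a • diagonal l := by
      rw [← diagonal_smul]; rfl
    rw [this, Matrix.mul_smul, Matrix.smul_mul]
  have hone : U * diagonal (fun _ => 1) * Uᵀ = 1 := by rw [diagonal_one, Matrix.mul_one, hU']
  have e1 : (exp (W * diagonal m * Wᵀ)).trace =
      ∑ i, ∑ j, Real.exp (m i) * 1 * (Wᵀ * U) i j ^ 2 := by
    rw [← trace_mul_diagonal_mul_diagonal W U _ (fun _ => 1), hone, Matrix.mul_one,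
      exp_mul_diagonal_mul_transpose hW]
  rw [← hg, e1, hsm, hsm, exp_mul_diagonal_mul_transpose hW, exp_mul_diagonal_mul_transpose hU,
    trace_mul_diagonal_mul_diagonal, trace_mul_diagonal_mul_diagonal, ← Finset.sum_add_distrib]
  refine Finset.sum_le_sum fun i _ => ?_
  rw [← Finset.sum_add_distrib]
  refine Finset.sum_le_sum fun j _ => ?_
  rw [← add_mul, ← mul_add, hg]
  have := exp_mul_le_one_add_chord t hR (hl j).1 (hl j).2
  gcongr

/-- A Bernoulli variable inside a trace exponential. -/
theorem bernoulli_trace_exp_le [Nonempty k] {H Y : Matrix k k ℝ} (hH : H.IsSymm) (hY : Y.IsSymm)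
    {R : ℝ} (hR : 0 < R) (h0 : ∀ x : k → ℝ, 0 ≤ x ⬝ᵥ (Y *ᵥ x))
    (h1 : ∀ x : k → ℝ, x ⬝ᵥ (Y *ᵥ x) ≤ R * (x ⬝ᵥ x)) (t : ℝ) {p : ℝ} (hp : 0 ≤ p) :
    (1 - p) * (exp H).trace + p * (exp (H + t • Y)).trace ≤
      (exp (H + (p * ((Real.exp (t * R) - 1) / R)) • Y)).trace := by
  have hsm : ∀ a : ℝ, (a • Y).IsSymm := fun a => by rw [IsSymm, transpose_smul, hY.eq]
  have hGT := (trace_exp_add_le hH (hsm t)).trans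
    (trace_exp_mul_exp_smul_le hH hY hR h0 h1 t)
  refine le_trans ?_ (trace_exp_add_trace_exp_mul_le hH (hsm _))
  have := mul_le_mul_of_nonneg_left hGT hp
  rw [Matrix.mul_smul, trace_smul, smul_eq_mul] at this ⊢
  linarith

end Matrix

/-! ### Independent random subsets -/

/-- The probability that a random subset of `s` that contains each `i` independently with
probability `p i` equals `T`. -/
def subsetWeight {ι : Type*} [DecidableEq ι] (p : ι → ℝ) (s T : Finset ι) : ℝ :=
  (∏ i ∈ T, p i) * ∏ i ∈ s \ T, (1 - p i)

section SubsetWeight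

variable {ι : Type*} [DecidableEq ι] {p : ι → ℝ} {s : Finset ι}

theorem subsetWeight_nonneg (hp : ∀ i, 0 ≤ p i ∧ p i ≤ 1) (s T : Finset ι) :
    0 ≤ subsetWeight p s T :=
  mul_nonneg (Finset.prod_nonneg fun i _ => (hp i).1)
    (Finset.prod_nonneg fun i _ => sub_nonneg.2 (hp i).2)

theorem sum_subsetWeight_insert (p : ι → ℝ) {j : ι} (hj : j ∉ s) (f : Finset ι → ℝ) :
    ∑ T ∈ (insert j s).powerset, subsetWeight p (insert j s) T * f T =
      (1 - p j) * ∑ T ∈ s.powerset, subsetWeight p s T * f T +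
        p j * ∑ T ∈ s.powerset, subsetWeight p s T * f (insert j T) := by
  rw [Finset.sum_powerset_insert hj, Finset.mul_sum, Finset.mul_sum]
  congr 1
  · refine Finset.sum_congr rfl fun T hT => ?_
    have hjT : j ∉ T := fun h => hj (Finset.mem_powerset.1 hT h)
    rw [subsetWeight, subsetWeight, Finset.insert_sdiff_of_notMem _ hjT,
      Finset.prod_insert (fun h => hj (Finset.mem_sdiff.1 h).1)]
    ring
  · refine Finset.sum_congr rfl fun T hT => ?_
    have hjT : j ∉ T := fun h => hj (Finset.mem_powerset.1 hT h)
    rw [subsetWeight, subsetWeight, Finset.insert_sdiff_insert, Finset.prod_insert hjT,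
      Finset.sdiff_insert_of_notMem hj]
    ring

end SubsetWeight

/-! ### Matrix Chernoff bounds -/

namespace Matrix

open NormedSpace

variable {k ι : Type*} [Fintype k] [DecidableEq k] [DecidableEq ι]

theorem isSymm_sum {k ι : Type*} {s : Finset ι} {X : ι → Matrix k k ℝ} (hX : ∀ i, (X i).IsSymm) :
    (∑ i ∈ s, X i).IsSymm := by
  rw [IsSymm, transpose_sum]
  exact Finset.sum_congr rfl fun i _ => (hX i).eq

/-- Random summands are exchanged for deterministic ones one index at a time. This works because the
single-step hypothesis holds for every symmetric H, which absorbs all other terms. -/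
theorem sum_subsetWeight_mul_trace_exp_le {p : ι → ℝ} (hp : ∀ i, 0 ≤ p i ∧ p i ≤ 1)
    {X Z : ι → Matrix k k ℝ} (hX : ∀ i, (X i).IsSymm) (hZ : ∀ i, (Z i).IsSymm) {s : Finset ι}
    (hstep : ∀ i ∈ s, ∀ H : Matrix k k ℝ, H.IsSymm →
      (1 - p i) * (exp H).trace + p i * (exp (H + X i)).trace ≤ (exp (H + Z i)).trace)
    {H : Matrix k k ℝ} (hH : H.IsSymm) :
    ∑ T ∈ s.powerset, subsetWeight p s T * (exp (H + ∑ i ∈ T, X i)).trace ≤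
      (exp (H + ∑ i ∈ s, Z i)).trace := by
  induction s using Finset.induction_on generalizing H with
  | empty => simp [subsetWeight]
  | insert j s hj ih =>
    have ih' := fun {H} => @ih (fun i hi => hstep i (Finset.mem_insert_of_mem hi)) H
    rw [sum_subsetWeight_insert p hj (fun T => (exp (H + ∑ i ∈ T, X i)).trace)]
    have e : ∑ T ∈ s.powerset, subsetWeight p s T * (exp (H + ∑ i ∈ insert j T, X i)).trace =
        ∑ T ∈ s.powerset, subsetWeight p s T * (exp ((H + X j) + ∑ i ∈ T, X i)).trace := by
      refine Finset.sum_congr rfl fun T hT => ?_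
      rw [Finset.sum_insert fun h => hj (Finset.mem_powerset.1 hT h), add_assoc]
    rw [e]
    have h1 := mul_le_mul_of_nonneg_left (ih' hH) (sub_nonneg.2 (hp j).2)
    have h2 := mul_le_mul_of_nonneg_left (ih' (hH.add (hX j))) (hp j).1
    have h3 := hstep j (Finset.mem_insert_self _ _) _ (hH.add (isSymm_sum (s := s) hZ))
    rw [Finset.sum_insert hj]
    have e1 : H + X j + ∑ i ∈ s, Z i = H + ∑ i ∈ s, Z i + X j := by abel
    have e2 : H + (Z j + ∑ i ∈ s, Z i) = H + ∑ i ∈ s, Z i + Z j := by abel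
    rw [e1] at h2
    rw [e2]
    linarith

theorem isSymm_vecMulVec_self {k : Type*} (v : k → ℝ) : (vecMulVec v v).IsSymm := by
  rw [IsSymm, transpose_vecMulVec]

theorem dotProduct_vecMulVec_self_mulVec {k : Type*} [Fintype k] (v x : k → ℝ) :
    x ⬝ᵥ (vecMulVec v v *ᵥ x) = (v ⬝ᵥ x) ^ 2 := by
  rw [vecMulVec_mulVec]
  simp [dotProduct_comm x v, pow_two]

theorem dotProduct_sum_smul_vecMulVec_mulVec {k ι : Type*} [Fintype k] (s : Finset ι)
    (c : ι → ℝ) (v : ι → k → ℝ) (x : k → ℝ) : x ⬝ᵥ ((∑ i ∈ s, c i • vecMulVec (v i) (v i)) *ᵥ x) =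
      ∑ i ∈ s, c i * (v i ⬝ᵥ x) ^ 2 := by
  rw [sum_mulVec, dotProduct_sum]
  refine Finset.sum_congr rfl fun i _ => ?_
  rw [smul_mulVec, dotProduct_smul, dotProduct_vecMulVec_self_mulVec, smul_eq_mul]

open Classical in
/-- A matrix Chernoff bound in isotropic position. -/
theorem matrix_chernoff_isotropic [Nonempty k] {p : ι → ℝ} (hp : ∀ i, 0 ≤ p i ∧ p i ≤ 1)
    (s : Finset ι) (v : ι → k → ℝ) {R θ : ℝ} (hR : 0 < R) (hθ : |θ * R| ≤ 1)
    (hv : ∀ i ∈ s, p i < 1 → ∀ x, (v i ⬝ᵥ x) ^ 2 ≤ R * (x ⬝ᵥ x))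
    (hsum : ∀ x, ∑ i ∈ s, p i * (v i ⬝ᵥ x) ^ 2 ≤ x ⬝ᵥ x) (η : ℝ) :
    ∑ T ∈ s.powerset with ∃ x, η * (x ⬝ᵥ x) <
        θ * (∑ i ∈ T, (v i ⬝ᵥ x) ^ 2 - ∑ i ∈ s, p i * (v i ⬝ᵥ x) ^ 2),
      subsetWeight p s T ≤ Fintype.card k * Real.exp (θ ^ 2 * R - η) := by
  obtain ⟨g, hg⟩ : ∃ g, g = (Real.exp (θ * R) - 1) / R := ⟨_, rfl⟩
  have hg0 : 0 ≤ g - θ := by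
    rw [hg, sub_nonneg, le_div_iff₀ hR]
    linarith [Real.add_one_le_exp (θ * R)]
  have hg1 : g - θ ≤ θ ^ 2 * R := by
    have h := (abs_le.1 (Real.abs_exp_sub_one_sub_id_le hθ)).2
    rw [hg, sub_le_iff_le_add, div_le_iff₀ hR]
    nlinarith
  set H : Matrix k k ℝ := ∑ i ∈ s, (-(θ * p i)) • vecMulVec (v i) (v i) with hHdef
  have hsm : ∀ (a : ℝ) i, (a • vecMulVec (v i) (v i)).IsSymm := fun a i => by
    rw [IsSymm, transpose_smul, (isSymm_vecMulVec_self _).eq]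
  have hH : H.IsSymm := isSymm_sum fun i => hsm _ i
  -- An index with `p i = 1` is deterministic and contributes exactly θ, with no chord bound. Hence
  -- no size bound on its vector is needed.
  have hstep : ∀ i ∈ s, ∀ H : Matrix k k ℝ, H.IsSymm →
      (1 - p i) * (exp H).trace + p i * (exp (H + θ • vecMulVec (v i) (v i))).trace ≤
        (exp (H + (if p i = 1 then θ else p i * g) • vecMulVec (v i) (v i))).trace := by
    intro i hi H hH
    split_ifs with h1
    · rw [h1]; simp
    · rw [hg]
      refine bernoulli_trace_exp_le hH (isSymm_vecMulVec_self _) hR (fun x => ?_) (fun x => ?_) θ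
        (hp i).1
      · rw [dotProduct_vecMulVec_self_mulVec]; positivity
      · rw [dotProduct_vecMulVec_self_mulVec]
        exact hv i hi (lt_of_le_of_ne (hp i).2 h1) x
  have hmgf := sum_subsetWeight_mul_trace_exp_le hp (fun i => hsm θ i) (fun i => hsm _ i) hstep hH
  have hup : (exp (H + ∑ i ∈ s, (if p i = 1 then θ else p i * g) •
      vecMulVec (v i) (v i))).trace ≤ Fintype.card k * Real.exp (θ ^ 2 * R) := by
    refine trace_exp_le_card_mul_exp (hH.add (isSymm_sum fun i => hsm _ i)) fun x => ?_
    rw [add_mulVec, dotProduct_add, hHdef, dotProduct_sum_smul_vecMulVec_mulVec,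
      dotProduct_sum_smul_vecMulVec_mulVec, ← Finset.sum_add_distrib]
    have hx : 0 ≤ x ⬝ᵥ x := (Finset.sum_nonneg fun i _ => mul_nonneg (hp i).1 (sq_nonneg _)).trans
      (hsum x)
    calc ∑ i ∈ s, (-(θ * p i) * (v i ⬝ᵥ x) ^ 2 +
          (if p i = 1 then θ else p i * g) * (v i ⬝ᵥ x) ^ 2)
        ≤ ∑ i ∈ s, (g - θ) * (p i * (v i ⬝ᵥ x) ^ 2) := by
          refine Finset.sum_le_sum fun i _ => ?_
          split_ifs with h1
          · rw [h1]
            have := mul_nonneg hg0 (sq_nonneg (v i ⬝ᵥ x))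
            linarith
          · linarith
      _ = (g - θ) * ∑ i ∈ s, p i * (v i ⬝ᵥ x) ^ 2 := by rw [Finset.mul_sum]
      _ ≤ (g - θ) * (x ⬝ᵥ x) := mul_le_mul_of_nonneg_left (hsum x) hg0
      _ ≤ _ := mul_le_mul_of_nonneg_right hg1 hx
  have hsymT : ∀ T : Finset ι, (H + ∑ i ∈ T, θ • vecMulVec (v i) (v i)).IsSymm := fun T =>
    hH.add (isSymm_sum fun i => hsm _ i)
  -- Markov's inequality: on the bad event some eigenvalue of the exponent exceeds η, so the trace
  -- exponential is at least exp η.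
  have hmarkov : Real.exp η * ∑ T ∈ s.powerset with ∃ x, η * (x ⬝ᵥ x) <
        θ * (∑ i ∈ T, (v i ⬝ᵥ x) ^ 2 - ∑ i ∈ s, p i * (v i ⬝ᵥ x) ^ 2),
      subsetWeight p s T ≤ Fintype.card k * Real.exp (θ ^ 2 * R) := by
    refine le_trans ?_ (hmgf.trans hup)
    rw [Finset.mul_sum]
    refine (Finset.sum_le_sum fun T hT => ?_).trans
      (Finset.sum_le_sum_of_subset_of_nonneg (Finset.filter_subset _ _) fun T _ _ =>
        mul_nonneg (subsetWeight_nonneg hp s T) (trace_exp_nonneg (hsymT T)))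
    obtain ⟨x, hx⟩ := (Finset.mem_filter.1 hT).2
    rw [mul_comm]
    refine mul_le_mul_of_nonneg_left (exp_le_trace_exp (hsymT T) (x := x) ?_)
      (subsetWeight_nonneg hp s T)
    rw [add_mulVec, dotProduct_add, hHdef, dotProduct_sum_smul_vecMulVec_mulVec,
      dotProduct_sum_smul_vecMulVec_mulVec]
    refine hx.trans_eq ?_
    rw [mul_sub, Finset.mul_sum, Finset.mul_sum, sub_eq_add_neg, ← Finset.sum_neg_distrib, add_comm]
    congr 1
    exact Finset.sum_congr rfl fun i _ => by ring
  rw [Real.exp_sub, ← mul_div_assoc, le_div_iff₀ (Real.exp_pos _), mul_comm]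
  exact hmarkov

/-- W is an inverse square root of M up to a rotation. It turns the form of M into the Euclidean
one, which reduces a relative bound to the isotropic case. -/
theorem exists_whitening {M : Matrix k k ℝ} (hM : M.IsSymm) {r : ℝ} (hr : 0 < r)
    (h : ∀ x : k → ℝ, r * (x ⬝ᵥ x) ≤ x ⬝ᵥ (M *ᵥ x)) :
    ∃ W V : Matrix k k ℝ, W * V = 1 ∧
      ∀ y, (W *ᵥ y) ⬝ᵥ (M *ᵥ (W *ᵥ y)) = y ⬝ᵥ y := by
  obtain ⟨U, l, hU, hU', rfl⟩ := exists_diagonalization hM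
  have hl : ∀ j, 0 < l j := by
    intro j
    obtain ⟨x, hx1, hx2⟩ := exists_dotProduct_mulVec_eq hU l j
    have := h x
    rw [hx1, hx2, mul_one] at this
    exact hr.trans_le this
  have hsq : ∀ j, √(l j) ≠ 0 := fun j => (Real.sqrt_pos.2 (hl j)).ne'
  refine ⟨U * diagonal (fun j => (√(l j))⁻¹), diagonal (fun j => √(l j)) * Uᵀ, ?_, fun y => ?_⟩
  · rw [Matrix.mul_assoc, ← Matrix.mul_assoc (diagonal _) (diagonal _), diagonal_mul_diagonal]
    simp [hsq, hU']
  · rw [dotProduct_mulVec_diagonalization, mulVec_mulVec, ← Matrix.mul_assoc, hU, Matrix.one_mul]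
    simp only [mulVec_diagonal, dotProduct]
    refine Finset.sum_congr rfl fun j _ => ?_
    rw [mul_pow, inv_pow, Real.sq_sqrt (hl j).le, ← mul_assoc, mul_inv_cancel₀ (hl j).ne', one_mul,
      pow_two]

open Classical in
/-- A matrix Chernoff bound for quadratic forms, with ridge parameter `r`. -/
theorem matrix_chernoff [Nonempty k] {p : ι → ℝ} (hp : ∀ i, 0 ≤ p i ∧ p i ≤ 1)
    (s : Finset ι) (b : ι → k → ℝ) {R r ε σ : ℝ} (hR : 0 < R) (hr : 0 < r) (hε : 0 < ε)
    (hε2 : ε ≤ 2) (hσ : |σ| = 1) (hb : ∀ i ∈ s, p i < 1 → ∀ x,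
      (b i ⬝ᵥ x) ^ 2 ≤ R * (∑ i ∈ s, p i * (b i ⬝ᵥ x) ^ 2 + r * (x ⬝ᵥ x))) :
    ∑ T ∈ s.powerset with ∃ x, ε * (∑ i ∈ s, p i * (b i ⬝ᵥ x) ^ 2 + r * (x ⬝ᵥ x)) <
        σ * (∑ i ∈ T, (b i ⬝ᵥ x) ^ 2 - ∑ i ∈ s, p i * (b i ⬝ᵥ x) ^ 2),
      subsetWeight p s T ≤ Fintype.card k * Real.exp (-(ε ^ 2 / (4 * R))) := by
  set M : Matrix k k ℝ := ∑ i ∈ s, p i • vecMulVec (b i) (b i) + r • 1 with hMdef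
  have hMq : ∀ x, x ⬝ᵥ (M *ᵥ x) = ∑ i ∈ s, p i * (b i ⬝ᵥ x) ^ 2 + r * (x ⬝ᵥ x) := by
    intro x
    rw [hMdef, add_mulVec, dotProduct_add, dotProduct_sum_smul_vecMulVec_mulVec, smul_mulVec,
      one_mulVec, dotProduct_smul, smul_eq_mul]
  have hM : M.IsSymm := by
    refine IsSymm.add (isSymm_sum fun i => ?_) ?_
    · rw [IsSymm, transpose_smul, (isSymm_vecMulVec_self _).eq]
    · rw [IsSymm, transpose_smul, transpose_one]
  have hnn : ∀ x, 0 ≤ ∑ i ∈ s, p i * (b i ⬝ᵥ x) ^ 2 := fun x =>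
    Finset.sum_nonneg fun i _ => mul_nonneg (hp i).1 (sq_nonneg _)
  have hxx : ∀ x : k → ℝ, 0 ≤ x ⬝ᵥ x := fun x => by
    simpa using dotProduct_star_self_nonneg x
  obtain ⟨W, V, hWV, hW⟩ := exists_whitening hM hr fun x => by
    rw [hMq]; linarith [hnn x]
  have hdot : ∀ i y, (Wᵀ *ᵥ b i) ⬝ᵥ y = b i ⬝ᵥ (W *ᵥ y) := by
    intro i y
    rw [dotProduct_mulVec, mulVec_transpose]
  -- The value |θ| = ε/(2R) minimizes θ²R - |θ|ε, with minimum -ε²/(4R). The sign σ selects the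
  -- tail, and ε ≤ 2 keeps |θR| ≤ 1.
  have hθ : |σ * ε / (2 * R) * R| ≤ 1 := by
    have : σ * ε / (2 * R) * R = σ * (ε / 2) := by field_simp
    rw [this, abs_mul, hσ, one_mul, abs_of_pos (by positivity)]
    linarith
  have hσ2 : σ ^ 2 = 1 := by rw [← sq_abs, hσ, one_pow]
  have key := matrix_chernoff_isotropic hp s (fun i => Wᵀ *ᵥ b i) hR hθ
    (fun i hi hpi x => by rw [hdot, ← hW x, hMq]; exact hb i hi hpi _)
    (fun x => by
      simp only [hdot]
      rw [← hW x, hMq]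
      exact le_add_of_nonneg_right (mul_nonneg hr.le (hxx _))) (ε ^ 2 / (2 * R))
  have hexp : (σ * ε / (2 * R)) ^ 2 * R - ε ^ 2 / (2 * R) = -(ε ^ 2 / (4 * R)) := by
    field_simp
    rw [hσ2]; ring
  rw [hexp] at key
  refine le_trans (Finset.sum_le_sum_of_subset_of_nonneg ?_ fun T _ _ =>
    subsetWeight_nonneg hp s T) key
  intro T hT
  rw [Finset.mem_filter] at hT ⊢
  obtain ⟨hTs, x, hx⟩ := hT
  refine ⟨hTs, V *ᵥ x, ?_⟩
  simp only [hdot]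
  rw [← hW (V *ᵥ x), mulVec_mulVec, hWV, one_mulVec, hMq]
  have hpos : 0 < ε / (2 * R) := by positivity
  have := mul_lt_mul_of_pos_left hx hpos
  calc _ = ε / (2 * R) * (ε * (∑ i ∈ s, p i * (b i ⬝ᵥ x) ^ 2 + r * (x ⬝ᵥ x))) := by ring
    _ < _ := this
    _ = _ := by ring

end Matrix

/-! ### Ridge terms, reweighting, and domination by a uniform sample -/

section QuadraticForms

variable {k ι : Type*} [Fintype k]

theorem dotProduct_self_nonneg_real (x : k → ℝ) : 0 ≤ x ⬝ᵥ x :=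
  Finset.sum_nonneg fun _ _ => mul_self_nonneg _

theorem dotProduct_sq_le (u v : k → ℝ) : (u ⬝ᵥ v) ^ 2 ≤ (u ⬝ᵥ u) * (v ⬝ᵥ v) := by
  have h := Finset.sum_mul_sq_le_sq_mul_sq Finset.univ u v
  simpa only [dotProduct, pow_two (u _), pow_two (v _)] using h

/-- Finitely many inequalities that hold up to a small enough ridge term hold without it. -/
theorem exists_ridge [Finite ι] (f g : ι → (k → ℝ) → ℝ) :
    ∃ r : ℝ, 0 < r ∧ ∀ j, (∀ x, f j x ≤ g j x + r * (x ⬝ᵥ x)) → ∀ x, f j x ≤ g j x := by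
  have h1 : ∀ j, ∃ r : ℝ, 0 < r ∧ ((∀ x, f j x ≤ g j x + r * (x ⬝ᵥ x)) → ∀ x, f j x ≤ g j x) := by
    intro j
    by_cases hj : ∀ x, f j x ≤ g j x
    · exact ⟨1, one_pos, fun _ => hj⟩
    · push Not at hj
      obtain ⟨x, hx⟩ := hj
      have hx0 := dotProduct_self_nonneg_real x
      -- At a point x that violates the inequality, this ridge recovers at most half of the gap, so
      -- the ridged inequality fails there too.
      refine ⟨(f j x - g j x) / (2 * (x ⬝ᵥ x + 1)), div_pos (sub_pos.2 hx) (by positivity),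
        fun h => ?_⟩
      have h2 := h x
      have h3 : (f j x - g j x) / (2 * (x ⬝ᵥ x + 1)) * (x ⬝ᵥ x) ≤ (f j x - g j x) / 2 := by
        rw [div_mul_eq_mul_div, div_le_div_iff₀ (by positivity) two_pos]
        nlinarith
      linarith
  choose r hr0 hr using h1
  rcases isEmpty_or_nonempty ι with hι | hι
  · exact ⟨1, one_pos, fun j => hι.elim j⟩
  · obtain ⟨j₀, hj₀⟩ := Finite.exists_min r
    refine ⟨r j₀, hr0 j₀, fun j h => hr j fun x => (h x).trans ?_⟩
    have := mul_le_mul_of_nonneg_right (hj₀ j) (dotProduct_self_nonneg_real x)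
    linarith

variable [DecidableEq k] [Fintype ι] [DecidableEq ι]

/-- A reweighting of the rows `a i` that makes all ridge leverage scores at most `α` and changes
few rows. -/
theorem exists_reweighting (a : ι → k → ℝ) {α r : ℝ} (hα : 0 < α) (hr : 0 < r) :
    ∃ w : ι → ℝ, (∀ i, 0 ≤ w i ∧ w i ≤ 1) ∧
      (∀ i x, w i * (a i ⬝ᵥ x) ^ 2 ≤ α * (∑ j, w j * (a j ⬝ᵥ x) ^ 2 + r * (x ⬝ᵥ x))) ∧
      α * ((Finset.univ.filter fun i => w i ≠ 1).card : ℝ) ≤ Fintype.card k := by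
  -- Extremal argument: w maximizes the total weight over the compact set of admissible weights. At
  -- the maximum every row of weight below 1 has score at least α, and the scores sum to at most the
  -- dimension, so such rows are few.
  set F : Set (ι → ℝ) := Set.Icc 0 1 ∩ {w | ∀ i x, w i * (a i ⬝ᵥ x) ^ 2 ≤
    α * (∑ j, w j * (a j ⬝ᵥ x) ^ 2 + r * (x ⬝ᵥ x))} with hF
  have hFc : IsCompact F := by
    refine isCompact_Icc.inter_right ?_
    simp only [Set.ofPred_forall]
    refine isClosed_iInter fun i => isClosed_iInter fun x => isClosed_le ?_ ?_ <;> fun_prop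
  have hFn : F.Nonempty := by
    refine ⟨0, ⟨le_refl _, zero_le_one⟩, fun i x => ?_⟩
    have := dotProduct_self_nonneg_real x
    simp only [Pi.zero_apply, zero_mul, Finset.sum_const_zero, zero_add]
    positivity
  obtain ⟨w, hwF, hmax⟩ := hFc.exists_isMaxOn hFn
    (f := fun w : ι → ℝ => ∑ i, w i) (by fun_prop)
  obtain ⟨⟨hw0, hw1⟩, hwα⟩ := hwF
  refine ⟨w, fun i => ⟨hw0 i, hw1 i⟩, hwα, ?_⟩
  set M : Matrix k k ℝ := ∑ i, w i • Matrix.vecMulVec (a i) (a i) + r • 1 with hMdef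
  have hMq : ∀ x, x ⬝ᵥ (M *ᵥ x) = ∑ i, w i * (a i ⬝ᵥ x) ^ 2 + r * (x ⬝ᵥ x) := by
    intro x
    rw [hMdef, Matrix.add_mulVec, dotProduct_add, Matrix.dotProduct_sum_smul_vecMulVec_mulVec,
      Matrix.smul_mulVec, Matrix.one_mulVec, dotProduct_smul, smul_eq_mul]
  have hM : M.IsSymm := by
    refine Matrix.IsSymm.add (Matrix.isSymm_sum fun i => ?_) ?_
    · rw [Matrix.IsSymm, Matrix.transpose_smul, (Matrix.isSymm_vecMulVec_self _).eq]
    · rw [Matrix.IsSymm, Matrix.transpose_smul, Matrix.transpose_one]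
  have hnn : ∀ x, 0 ≤ ∑ i, w i * (a i ⬝ᵥ x) ^ 2 := fun x =>
    Finset.sum_nonneg fun i _ => mul_nonneg (hw0 i) (sq_nonneg _)
  obtain ⟨W, V, hWV, hW⟩ := Matrix.exists_whitening hM hr fun x => by
    rw [hMq]; linarith [hnn x]
  have hdot : ∀ i y, (Wᵀ *ᵥ a i) ⬝ᵥ y = a i ⬝ᵥ (W *ᵥ y) := by
    intro i y
    rw [Matrix.dotProduct_mulVec, Matrix.mulVec_transpose]
  obtain ⟨τ, hτ⟩ : ∃ τ : ι → ℝ, ∀ i, τ i = w i * ((Wᵀ *ᵥ a i) ⬝ᵥ (Wᵀ *ᵥ a i)) := ⟨_, fun _ => rfl⟩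
  have hτ0 : ∀ i, 0 ≤ τ i := fun i => by
    rw [hτ]; exact mul_nonneg (hw0 i) (dotProduct_self_nonneg_real _)
  have hτq : ∀ i x, w i * (a i ⬝ᵥ x) ^ 2 ≤
      τ i * (∑ j, w j * (a j ⬝ᵥ x) ^ 2 + r * (x ⬝ᵥ x)) := by
    intro i x
    have hx : W *ᵥ (V *ᵥ x) = x := by rw [Matrix.mulVec_mulVec, hWV, Matrix.one_mulVec]
    have h := dotProduct_sq_le (Wᵀ *ᵥ a i) (V *ᵥ x)
    rw [hdot, hx, ← hW (V *ᵥ x), hx, hMq] at h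
    rw [hτ, mul_assoc]
    exact mul_le_mul_of_nonneg_left h (hw0 i)
  -- The sum is the trace of the whitened weighted Gram matrix without its ridge part. Each diagonal
  -- entry is at most 1.
  have hτsum : ∑ i, τ i ≤ Fintype.card k := by
    have hcol : ∀ j, ∑ i, w i * (a i ⬝ᵥ (W *ᵥ Pi.single j 1)) ^ 2 ≤ 1 := by
      intro j
      have h := hW (Pi.single j 1)
      rw [hMq] at h
      have h1 : (Pi.single j 1 : k → ℝ) ⬝ᵥ Pi.single j 1 = 1 := by simp
      have h2 := mul_nonneg hr.le (dotProduct_self_nonneg_real (W *ᵥ Pi.single j 1))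
      linarith
    have h : ∀ i, τ i = ∑ j, w i * (a i ⬝ᵥ (W *ᵥ Pi.single j 1)) ^ 2 := by
      intro i
      rw [hτ, ← Finset.mul_sum]
      congr 1
      simp only [← hdot, dotProduct_single_one]
      exact Finset.sum_congr rfl fun j _ => (pow_two _).symm
    simp only [h]
    rw [Finset.sum_comm]
    calc _ ≤ ∑ _j : k, (1 : ℝ) := Finset.sum_le_sum fun j _ => hcol j
      _ = _ := by simp
  have hge : ∀ i, w i ≠ 1 → α ≤ τ i := by
    intro i hi
    by_contra! hlt
    have hi1 : w i < 1 := lt_of_le_of_ne (hw1 i) hi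
    have ha0 := dotProduct_self_nonneg_real (a i)
    -- The slack (α - τ i)·r·|x|² supplied by the ridge absorbs the increase δ(a_i·x)², by
    -- Cauchy-Schwarz. For the other rows only the right-hand side grows.
    obtain ⟨δ, hδ⟩ : ∃ δ, δ = min (1 - w i) ((α - τ i) * r / (a i ⬝ᵥ a i + 1)) := ⟨_, rfl⟩
    have hδ0 : 0 < δ := by
      rw [hδ]
      exact lt_min (sub_pos.2 hi1) (div_pos (mul_pos (sub_pos.2 hlt) hr) (by positivity))
    have hδ1 : δ ≤ 1 - w i := hδ ▸ min_le_left _ _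
    have hδ2 : δ * (a i ⬝ᵥ a i) ≤ (α - τ i) * r := by
      have h := hδ ▸ min_le_right (1 - w i) ((α - τ i) * r / (a i ⬝ᵥ a i + 1))
      rw [le_div_iff₀ (by positivity)] at h
      linarith
    have hw' : ∀ j, (w + (Pi.single i δ : ι → ℝ)) j = w j + if j = i then δ else 0 := by
      intro j
      simp [Pi.single_apply]
    have hle : ∀ x, ∑ j, w j * (a j ⬝ᵥ x) ^ 2 ≤
        ∑ j, (w + (Pi.single i δ : ι → ℝ)) j * (a j ⬝ᵥ x) ^ 2 := by
      intro x
      refine Finset.sum_le_sum fun j _ => mul_le_mul_of_nonneg_right ?_ (sq_nonneg _)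
      rw [hw']
      split_ifs <;> linarith
    have hmem : w + (Pi.single i δ : ι → ℝ) ∈ F := by
      refine ⟨⟨fun j => ?_, fun j => ?_⟩, fun j x => ?_⟩
      · rw [hw']
        have := hw0 j
        simp only [Pi.zero_apply] at this ⊢
        split_ifs <;> linarith
      · rw [hw']
        have := hw1 j
        simp only [Pi.one_apply] at this ⊢
        split_ifs with h
        · rw [h]; linarith
        · linarith
      · refine le_trans ?_ (mul_le_mul_of_nonneg_left (add_le_add_left (hle x) _) hα.le)
        rw [hw']
        split_ifs with h
        · subst h
          have h1 := hτq j x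
          have h2 := mul_le_mul_of_nonneg_left (dotProduct_sq_le (a j) x) hδ0.le
          have h3 := mul_le_mul_of_nonneg_right hδ2 (dotProduct_self_nonneg_real x)
          have h4 := mul_nonneg (sub_pos.2 hlt).le (hnn x)
          nlinarith
        · rw [add_zero]
          exact hwα j x
    have h := hmax hmem
    simp only [Set.mem_ofPred_eq, Pi.add_apply, Finset.sum_add_distrib, Finset.sum_pi_single',
      Finset.mem_univ, if_true] at h
    linarith
  calc α * ((Finset.univ.filter fun i => w i ≠ 1).card : ℝ)
      = ∑ i ∈ Finset.univ.filter fun i => w i ≠ 1, α := by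
        rw [Finset.sum_const, nsmul_eq_mul, mul_comm]
    _ ≤ ∑ i ∈ Finset.univ.filter fun i => w i ≠ 1, τ i :=
        Finset.sum_le_sum fun i hi => hge i (Finset.mem_filter.1 hi).2
    _ ≤ ∑ i, τ i := Finset.sum_le_sum_of_subset_of_nonneg (Finset.filter_subset _ _)
        fun i _ _ => hτ0 i
    _ ≤ _ := hτsum

open Classical in
/-- A uniform sample of half of the rows dominates, up to a constant, all but few of the rows. -/
theorem exists_dominated_rows [Nonempty k] (a : ι → k → ℝ) {α : ℝ} (hα : 0 < α) :
    ∃ G : Finset ι, α * (Gᶜ.card : ℝ) ≤ Fintype.card k ∧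
      ∑ S ∈ Finset.univ.powerset with ¬ ∀ x, ∑ i ∈ G, (a i ⬝ᵥ x) ^ 2 ≤
          4 * ∑ i ∈ S, (a i ⬝ᵥ x) ^ 2,
        subsetWeight (fun _ => 1 / 2) Finset.univ S ≤
          Fintype.card k * Real.exp (-(1 / (32 * α))) := by
  -- The set G produced below depends on r, so r is chosen to serve all pairs (G, S) at once.
  obtain ⟨r, hr, hridge⟩ := exists_ridge (k := k) (ι := Finset ι × Finset ι)
    (fun j x => ∑ i ∈ j.1, (a i ⬝ᵥ x) ^ 2) (fun j x => 4 * ∑ i ∈ j.2, (a i ⬝ᵥ x) ^ 2)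
  obtain ⟨w, hw01, hwα, hwcard⟩ := exists_reweighting a hα hr
  have hsq : ∀ i x, ((√(w i) • a i) ⬝ᵥ x) ^ 2 = w i * (a i ⬝ᵥ x) ^ 2 := by
    intro i x
    rw [smul_dotProduct, smul_eq_mul, mul_pow, Real.sq_sqrt (hw01 i).1]
  -- The lower tail for the reweighted rows. Halving the mean form doubles the score bound to 2α and
  -- halves the ridge; relative error 1/2 leaves a quarter of the full weighted form, hence the
  -- factor 4.
  have key := Matrix.matrix_chernoff (k := k) (ι := ι) (p := fun _ => 1 / 2)
    (fun _ => by norm_num) Finset.univ (fun i => √(w i) • a i) (R := 2 * α) (r := r / 2)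
    (ε := 1 / 2) (σ := -1) (by positivity) (by positivity) (by norm_num) (by norm_num) (by simp)
    (fun i _ _ x => by
      simp only [hsq, ← Finset.mul_sum]
      have := hwα i x
      linarith)
  refine ⟨Finset.univ.filter fun i => w i = 1, ?_, ?_⟩
  · rwa [Finset.compl_filter]
  · have hexp : -((1 / 2 : ℝ) ^ 2 / (4 * (2 * α))) = -(1 / (32 * α)) := by
      congr 1
      field_simp
      norm_num
    rw [hexp] at key
    refine le_trans (Finset.sum_le_sum_of_subset_of_nonneg ?_ fun T _ _ =>
      subsetWeight_nonneg (fun _ => by norm_num) _ T) key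
    intro S hS
    rw [Finset.mem_filter] at hS ⊢
    refine ⟨hS.1, ?_⟩
    by_contra! hcon
    refine hS.2 (hridge (_, S) fun x => ?_)
    have h := hcon x
    simp only [hsq, ← Finset.mul_sum] at h
    have h1 : ∑ i ∈ Finset.univ.filter (fun i => w i = 1), (a i ⬝ᵥ x) ^ 2 ≤
        ∑ i, w i * (a i ⬝ᵥ x) ^ 2 := by
      calc _ = ∑ i ∈ Finset.univ.filter (fun i => w i = 1), w i * (a i ⬝ᵥ x) ^ 2 :=
            Finset.sum_congr rfl fun i hi => by rw [(Finset.mem_filter.1 hi).2, one_mul]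
        _ ≤ _ := Finset.sum_le_sum_of_subset_of_nonneg (Finset.filter_subset _ _)
            fun i _ _ => mul_nonneg (hw01 i).1 (sq_nonneg _)
    have h2 : ∑ i ∈ S, w i * (a i ⬝ᵥ x) ^ 2 ≤ ∑ i ∈ S, (a i ⬝ᵥ x) ^ 2 :=
      Finset.sum_le_sum fun i _ => mul_le_of_le_one_left (sq_nonneg _) (hw01 i).2
    refine h1.trans ?_
    change _ ≤ 4 * ∑ i ∈ S, (a i ⬝ᵥ x) ^ 2 + r * (x ⬝ᵥ x)
    linarith

end QuadraticForms

/-! ### Generalized leverage scores -/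

section Leverage

variable {m : Type*} [Fintype m] {d : ℕ}

theorem dotProduct_mulVec_transpose_mul_self {k : Type*} [Fintype k] (B : Matrix m k ℝ)
    (x y : k → ℝ) : x ⬝ᵥ ((Bᵀ * B) *ᵥ y) = (B *ᵥ x) ⬝ᵥ (B *ᵥ y) := by
  rw [← Matrix.mulVec_mulVec, Matrix.dotProduct_mulVec, Matrix.vecMul_transpose]

theorem dotProduct_mulVec_conjTranspose_mul_self (B : Matrix m (Fin d) ℝ) (x y : Fin d → ℝ) :
    x ⬝ᵥ ((Bᴴ * B) *ᵥ y) = (B *ᵥ x) ⬝ᵥ (B *ᵥ y) := by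
  rw [Matrix.conjTranspose_eq_transpose_of_trivial, dotProduct_mulVec_transpose_mul_self]

theorem keepRows_mulVec_dotProduct_self {n : ℕ} (A : Matrix (Fin n) (Fin d) ℝ)
    (S : Finset (Fin n)) (x : Fin d → ℝ) :
    (keepRows A S *ᵥ x) ⬝ᵥ (keepRows A S *ᵥ x) = ∑ i ∈ S, (A i ⬝ᵥ x) ^ 2 := by
  rw [← Finset.sum_coe_sort]
  exact Finset.sum_congr rfl fun i _ => (pow_two _).symm

theorem dotProduct_symmPinv_nonneg (B : Matrix m (Fin d) ℝ) (a : Fin d → ℝ) :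
    0 ≤ a ⬝ᵥ (symmPinv (Matrix.isHermitian_conjTranspose_mul_self B) *ᵥ a) := by
  rw [symmPinv, Matrix.dotProduct_mulVec_diagonalization]
  exact Finset.sum_nonneg fun j _ => mul_nonneg
    (inv_nonneg.2 ((Matrix.posSemidef_conjTranspose_mul_self B).eigenvalues_nonneg j))
    (sq_nonneg _)

/-- The generalized leverage score bounds the ratio of the quadratic forms of a row and of `B`. -/
theorem sq_le_genLeverage_mul {B : Matrix m (Fin d) ℝ} {a : Fin d → ℝ}
    (h : genLeverage B a ≠ ⊤) (x : Fin d → ℝ) :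
    (a ⬝ᵥ x) ^ 2 ≤ (genLeverage B a).toReal * ((B *ᵥ x) ⬝ᵥ (B *ᵥ x)) := by
  classical
  by_cases hker : ∀ x : Fin d → ℝ, B *ᵥ x = 0 → a ⬝ᵥ x = 0
  swap
  · rw [genLeverage, if_neg hker] at h
    exact absurd rfl h
  rw [genLeverage, if_pos hker, ENNReal.toReal_ofReal (dotProduct_symmPinv_nonneg B a)]
  have hN := Matrix.isHermitian_conjTranspose_mul_self B
  have hP := symmPinv_isPseudoInverse hN
  set P := symmPinv hN with hPdef
  have hPs : Pᵀ = P := by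
    rw [hPdef, symmPinv]
    simp [Matrix.transpose_mul, Matrix.mul_assoc]
  -- Since a is orthogonal to ker B, a·x = (BPa)·(Bx). Cauchy-Schwarz then finishes, because |BPa|²
  -- = aᵀPa.
  have h0 : B *ᵥ (x - P *ᵥ ((Bᴴ * B) *ᵥ x)) = 0 := by
    rw [← dotProduct_self_eq_zero, ← dotProduct_mulVec_conjTranspose_mul_self, Matrix.mulVec_sub,
      Matrix.mulVec_mulVec, Matrix.mulVec_mulVec, ← Matrix.mul_assoc (Bᴴ * B) P (Bᴴ * B),
      hP.mul_mul_self, sub_self, dotProduct_zero]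
  have h1 := hker _ h0
  rw [dotProduct_sub, sub_eq_zero, Matrix.dotProduct_mulVec, ← Matrix.mulVec_transpose, hPs,
    dotProduct_mulVec_conjTranspose_mul_self] at h1
  rw [h1]
  refine (dotProduct_sq_le _ _).trans (le_of_eq ?_)
  congr 1
  rw [← dotProduct_mulVec_conjTranspose_mul_self]
  nth_rewrite 1 [← hPs]
  rw [Matrix.mulVec_transpose, ← Matrix.dotProduct_mulVec, Matrix.mulVec_mulVec,
    Matrix.mulVec_mulVec, hP.self_mul_mul]

/-- If the rows with index in `G` are dominated by `B`, then the sum of their generalized leverage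
scores is at most a constant times the dimension. -/
theorem sum_genLeverage_le {ι : Type*} {B : Matrix m (Fin d) ℝ} (a : ι → Fin d → ℝ) (G : Finset ι)
    {c : ℝ} (hc : 0 ≤ c)
    (h : ∀ x, ∑ i ∈ G, (a i ⬝ᵥ x) ^ 2 ≤ c * ((B *ᵥ x) ⬝ᵥ (B *ᵥ x))) :
    (∀ i ∈ G, genLeverage B (a i) ≠ ⊤) ∧
      ∑ i ∈ G, (genLeverage B (a i)).toReal ≤ c * d := by
  classical
  have hker : ∀ i ∈ G, ∀ x : Fin d → ℝ, B *ᵥ x = 0 → a i ⬝ᵥ x = 0 := by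
    intro i hi x hx
    have h1 := h x
    rw [hx, dotProduct_zero, mul_zero] at h1
    have h2 := Finset.single_le_sum (f := fun i => (a i ⬝ᵥ x) ^ 2) (fun _ _ => sq_nonneg _) hi
    exact pow_eq_zero_iff two_ne_zero |>.1 (le_antisymm (h2.trans h1) (sq_nonneg _))
  refine ⟨fun i hi => ?_, ?_⟩
  · rw [genLeverage, if_pos (hker i hi)]
    exact ENNReal.ofReal_ne_top
  have hN := Matrix.isHermitian_conjTranspose_mul_self B
  have hμ0 : ∀ j, 0 ≤ hN.eigenvalues j :=
    (Matrix.posSemidef_conjTranspose_mul_self B).eigenvalues_nonneg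
  obtain ⟨U, hU⟩ : ∃ U : Matrix (Fin d) (Fin d) ℝ,
    U = (hN.eigenvectorUnitary : Matrix (Fin d) (Fin d) ℝ) := ⟨_, rfl⟩
  have hUU : Uᵀ * U = 1 := by
    have h := Unitary.star_mul_self_of_mem hN.eigenvectorUnitary.2
    rwa [← hU, Matrix.star_eq_conjTranspose, Matrix.conjTranspose_eq_transpose_of_trivial] at h
  have hspec : Bᴴ * B = U * Matrix.diagonal hN.eigenvalues * Uᵀ := by
    have h := hN.spectral_theorem
    rw [Unitary.conjStarAlgAut_apply] at h
    simp only [← hU, Matrix.star_eq_conjTranspose,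
      Matrix.conjTranspose_eq_transpose_of_trivial U] at h
    exact h
  -- Domination is tested on the j-th eigenvector of BᵀB. After division by the eigenvalue each
  -- direction costs at most c; a zero eigenvalue costs nothing since `0⁻¹ = 0`.
  have hcol : ∀ j, ∑ i ∈ G, (Uᵀ *ᵥ a i) j ^ 2 ≤ c * hN.eigenvalues j := by
    intro j
    have h1 := h (U *ᵥ Pi.single j 1)
    rw [← dotProduct_mulVec_conjTranspose_mul_self, hspec,
      Matrix.dotProduct_mulVec_diagonalization] at h1
    simp only [Matrix.mulVec_mulVec, hUU, Matrix.one_mulVec] at h1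
    simp only [Pi.single_apply, ite_pow, one_pow, ne_eq, OfNat.ofNat_ne_zero, not_false_eq_true,
      zero_pow, mul_ite, mul_one, mul_zero, Finset.sum_ite_eq', Finset.mem_univ, if_true] at h1
    refine le_trans (le_of_eq ?_) h1
    refine Finset.sum_congr rfl fun i _ => ?_
    rw [Matrix.dotProduct_mulVec, ← Matrix.mulVec_transpose, dotProduct_single_one]
  have hsum : ∑ i ∈ G, (genLeverage B (a i)).toReal =
      ∑ j, (hN.eigenvalues j)⁻¹ * ∑ i ∈ G, (Uᵀ *ᵥ a i) j ^ 2 := by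
    simp only [Finset.mul_sum]
    rw [Finset.sum_comm]
    refine Finset.sum_congr rfl fun i hi => ?_
    rw [genLeverage, if_pos (hker i hi), ENNReal.toReal_ofReal (dotProduct_symmPinv_nonneg B _),
      symmPinv, Matrix.dotProduct_mulVec_diagonalization, ← hU]
  rw [hsum]
  calc _ ≤ ∑ _j : Fin d, c := by
        refine Finset.sum_le_sum fun j _ => ?_
        refine (mul_le_mul_of_nonneg_left (hcol j) (inv_nonneg.2 (hμ0 j))).trans ?_
        rw [mul_left_comm]
        exact mul_le_of_le_one_right hc inv_mul_le_one
    _ = _ := by simp [mul_comm]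

end Leverage

/-! ### Tail bound for the sample size and union bounds -/

theorem sum_filter_le_sum_filter_add_sum_filter {α : Type*} {s : Finset α} {f : α → ℝ}
    (hf : ∀ a, 0 ≤ f a) {P Q₁ Q₂ : α → Prop} [DecidablePred P]
    [DecidablePred Q₁] [DecidablePred Q₂] (h : ∀ a ∈ s, P a → Q₁ a ∨ Q₂ a) :
    ∑ a ∈ s with P a, f a ≤ ∑ a ∈ s with Q₁ a, f a + ∑ a ∈ s with Q₂ a, f a := by
  rw [Finset.sum_filter, Finset.sum_filter, Finset.sum_filter, ← Finset.sum_add_distrib]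
  refine Finset.sum_le_sum fun a ha => ?_
  have h0 := hf a
  have h1 := h a ha
  split_ifs <;> first | linarith | tauto

/-- Exponential Markov with parameter 1: as e < 3, each factor 1 + (e - 1)p is at most exp(2p), so
the threshold 3m leaves exp(2m - 3m). -/
theorem sum_subsetWeight_card_gt_le {ι : Type*} [DecidableEq ι] {p : ι → ℝ}
    (hp : ∀ i, 0 ≤ p i ∧ p i ≤ 1) (s : Finset ι) {m : ℝ} (hm : ∑ i ∈ s, p i ≤ m) :
    ∑ T ∈ s.powerset with 3 * m < (T.card : ℝ), subsetWeight p s T ≤ Real.exp (-m) := by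
  have hm0 : 0 ≤ m := (Finset.sum_nonneg fun i _ => (hp i).1).trans hm
  have hmgf : ∑ T ∈ s.powerset, subsetWeight p s T * Real.exp T.card ≤ Real.exp (2 * m) := by
    have e : ∀ T ∈ s.powerset, subsetWeight p s T * Real.exp T.card =
        (∏ i ∈ T, p i * Real.exp 1) * ∏ i ∈ s \ T, (1 - p i) := by
      intro T _
      rw [subsetWeight, Finset.prod_mul_distrib, Finset.prod_const, ← Real.exp_nat_mul, mul_one]
      ring
    rw [Finset.sum_congr rfl e, ← Finset.prod_add]
    calc ∏ i ∈ s, (p i * Real.exp 1 + (1 - p i)) ≤ ∏ i ∈ s, Real.exp (2 * p i) := by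
          refine Finset.prod_le_prod (fun i _ => ?_) fun i _ => ?_
          · have := mul_nonneg (hp i).1 (Real.exp_pos 1).le
            linarith [(hp i).2]
          · have h1 := mul_le_mul_of_nonneg_left Real.exp_one_lt_three.le (hp i).1
            have h2 := Real.add_one_le_exp (2 * p i)
            linarith
      _ = Real.exp (2 * ∑ i ∈ s, p i) := by rw [← Real.exp_sum, Finset.mul_sum]
      _ ≤ _ := Real.exp_le_exp.2 (by linarith)
  have hmarkov : Real.exp (3 * m) * ∑ T ∈ s.powerset with 3 * m < (T.card : ℝ),
      subsetWeight p s T ≤ Real.exp (2 * m) := by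
    refine le_trans ?_ hmgf
    rw [Finset.mul_sum]
    refine (Finset.sum_le_sum fun T hT => ?_).trans
      (Finset.sum_le_sum_of_subset_of_nonneg (Finset.filter_subset _ _) fun T _ _ =>
        mul_nonneg (subsetWeight_nonneg hp s T) (Real.exp_pos _).le)
    rw [mul_comm]
    exact mul_le_mul_of_nonneg_left (Real.exp_le_exp.2 (Finset.mem_filter.1 hT).2.le)
      (subsetWeight_nonneg hp s T)
  have e : Real.exp (-m) = Real.exp (2 * m) / Real.exp (3 * m) := by
    rw [← Real.exp_sub]; congr 1; ring
  rw [e, le_div_iff₀ (Real.exp_pos _), mul_comm]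
  exact hmarkov

open Classical in
theorem toOuterMeasure_indepSubset {n : ℕ} (p : Fin n → ℝ≥0∞) (hp : ∀ i, p i ≤ 1)
    (E : Set (Finset (Fin n))) :
    (indepSubset p hp).toOuterMeasure E =
      ENNReal.ofReal (∑ T ∈ Finset.univ.powerset with T ∈ E,
        subsetWeight (fun i => (p i).toReal) Finset.univ T) := by
  have hp' : ∀ i, 0 ≤ (p i).toReal ∧ (p i).toReal ≤ 1 := fun i =>
    ⟨ENNReal.toReal_nonneg, ENNReal.toReal_le_of_le_ofReal zero_le_one (by simpa using hp i)⟩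
  have hpt : ∀ i, p i ≠ ⊤ := fun i => ne_top_of_le_ne_top ENNReal.one_ne_top (hp i)
  rw [indepSubset, PMF.toOuterMeasure_ofFintype_apply, tsum_fintype,
    ENNReal.ofReal_sum_of_nonneg fun T _ => subsetWeight_nonneg hp' _ T, Finset.sum_filter,
    Finset.powerset_univ]
  refine Finset.sum_congr rfl fun T _ => ?_
  rw [Set.indicator_apply]
  refine if_congr Iff.rfl ?_ rfl
  rw [subsetWeight, ENNReal.ofReal_mul (Finset.prod_nonneg fun i _ => (hp' i).1),
    ENNReal.ofReal_prod_of_nonneg fun i _ => (hp' i).1,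
    ENNReal.ofReal_prod_of_nonneg fun i _ => sub_nonneg.2 (hp' i).2]
  congr 1
  · exact Finset.prod_congr rfl fun i _ => (ENNReal.ofReal_toReal (hpt i)).symm
  · refine Finset.prod_congr rfl fun i _ => ?_
    rw [ENNReal.ofReal_sub _ (hp' i).1, ENNReal.ofReal_one, ENNReal.ofReal_toReal (hpt i)]

theorem PMF.toOuterMeasure_le_one {α : Type*} (p : PMF α) (s : Set α) :
    p.toOuterMeasure s ≤ 1 := by
  rw [PMF.toOuterMeasure_apply, ← p.tsum_coe]
  exact ENNReal.tsum_le_tsum fun a => Set.indicator_le_self _ _ _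

theorem PMF.toOuterMeasure_bind_le {α β : Type*} (p : PMF α) (f : α → PMF β) {E : Set α}
    {F : Set β} {δ₁ δ₂ : ℝ≥0∞} (h₁ : p.toOuterMeasure Eᶜ ≤ δ₁)
    (h₂ : ∀ a ∈ E, (f a).toOuterMeasure F ≤ δ₂) : (p.bind f).toOuterMeasure F ≤ δ₁ + δ₂ := by
  rw [PMF.toOuterMeasure_bind_apply]
  calc ∑' a, p a * (f a).toOuterMeasure F ≤ ∑' a, (Eᶜ.indicator p a + p a * δ₂) := by
        refine ENNReal.tsum_le_tsum fun a => ?_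
        by_cases ha : a ∈ E
        · exact (mul_le_mul_right (h₂ a ha) _).trans le_add_self
        · rw [Set.indicator_of_mem (show a ∈ Eᶜ from ha)]
          exact (mul_le_of_le_one_right' ((f a).toOuterMeasure_le_one F)).trans le_self_add
    _ = p.toOuterMeasure Eᶜ + δ₂ := by
        rw [ENNReal.tsum_add, ENNReal.tsum_mul_right, p.tsum_coe, one_mul, PMF.toOuterMeasure_apply]
    _ ≤ _ := by gcongr

theorem PMF.one_sub_le_toReal_toOuterMeasure {α : Type*} (p : PMF α) {s : Set α} {δ : ℝ}
    (hδ : 0 ≤ δ) (h : p.toOuterMeasure sᶜ ≤ ENNReal.ofReal δ) :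
    1 - δ ≤ (p.toOuterMeasure s).toReal := by
  have h1 : (1 : ℝ≥0∞) ≤ p.toOuterMeasure s + ENNReal.ofReal δ := by
    calc (1 : ℝ≥0∞) = p.toOuterMeasure (s ∪ sᶜ) := by
          rw [Set.union_compl_self]
          exact ((p.toOuterMeasure_apply_eq_one_iff _).2 (Set.subset_univ _)).symm
      _ ≤ p.toOuterMeasure s + p.toOuterMeasure sᶜ := MeasureTheory.measure_union_le _ _
      _ ≤ _ := by gcongr
  have hne : p.toOuterMeasure s ≠ ⊤ :=
    ne_top_of_le_ne_top ENNReal.one_ne_top (p.toOuterMeasure_le_one s)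
  have h2 := ENNReal.toReal_mono (by finiteness) h1
  rw [ENNReal.toReal_one, ENNReal.toReal_add hne ENNReal.ofReal_ne_top,
    ENNReal.toReal_ofReal hδ] at h2
  linarith

/-! ### Sampling probabilities and accuracy of the second stage -/

section SampleProb

variable {n d : ℕ} {c ε : ℝ} {A : Matrix (Fin n) (Fin d) ℝ} {S : Finset (Fin n)}

theorem sampleProb_toReal_mem (c ε : ℝ) (A : Matrix (Fin n) (Fin d) ℝ) (S : Finset (Fin n))
    (i : Fin n) : 0 ≤ (sampleProb c ε A S i).toReal ∧ (sampleProb c ε A S i).toReal ≤ 1 :=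
  ⟨ENNReal.toReal_nonneg, ENNReal.toReal_le_of_le_ofReal zero_le_one (by
    rw [ENNReal.ofReal_one]; exact min_le_left _ _)⟩

theorem sampleProb_toReal_le (hL : 0 ≤ c * Real.log d / ε ^ 2) {i : Fin n}
    (h : genLeverage (keepRows A S) (A i) ≠ ⊤) :
    (sampleProb c ε A S i).toReal ≤
      c * Real.log d / ε ^ 2 * (genLeverage (keepRows A S) (A i)).toReal := by
  have h1 : sampleProb c ε A S i ≤
    ENNReal.ofReal (c * Real.log d / ε ^ 2) * genLeverage (keepRows A S) (A i) := min_le_right _ _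
  have h2 := ENNReal.toReal_mono (ENNReal.mul_ne_top ENNReal.ofReal_ne_top h) h1
  rwa [ENNReal.toReal_mul, ENNReal.toReal_ofReal hL] at h2

/-- A probability below 1 excludes an infinite score and equals its untruncated value. The form of
the rows in S is at most that of all rows, so the score from S is a valid bound for the full matrix.
-/
theorem sq_le_sampleProb_mul (hL : 0 < c * Real.log d / ε ^ 2) {i : Fin n}
    (h : (sampleProb c ε A S i).toReal < 1) (x : Fin d → ℝ) :
    c * Real.log d / ε ^ 2 * (A i ⬝ᵥ x) ^ 2 ≤
      (sampleProb c ε A S i).toReal * ∑ j, (A j ⬝ᵥ x) ^ 2 := by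
  have hlt : ENNReal.ofReal (c * Real.log d / ε ^ 2) * genLeverage (keepRows A S) (A i) < 1 := by
    by_contra! hcon
    rw [sampleProb, min_eq_left hcon] at h
    simp at h
  have hp : sampleProb c ε A S i =
      ENNReal.ofReal (c * Real.log d / ε ^ 2) * genLeverage (keepRows A S) (A i) :=
    min_eq_right hlt.le
  have htop : genLeverage (keepRows A S) (A i) ≠ ⊤ := by
    intro htop
    rw [htop, ENNReal.mul_top (by simpa using hL)] at hlt
    exact absurd hlt (by simp)
  rw [hp, ENNReal.toReal_mul, ENNReal.toReal_ofReal hL.le, mul_assoc]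
  refine mul_le_mul_of_nonneg_left ((sq_le_genLeverage_mul htop x).trans ?_) hL.le
  rw [keepRows_mulVec_dotProduct_self]
  exact mul_le_mul_of_nonneg_left (Finset.sum_le_sum_of_subset_of_nonneg (Finset.subset_univ _)
    fun _ _ _ => sq_nonneg _) ENNReal.toReal_nonneg

theorem sum_sampleProb_le (hL : 0 ≤ c * Real.log d / ε ^ 2) {G : Finset (Fin n)} {κ : ℝ}
    (hκ : 0 ≤ κ) (h : ∀ x, ∑ i ∈ G, (A i ⬝ᵥ x) ^ 2 ≤ κ * ∑ i ∈ S, (A i ⬝ᵥ x) ^ 2) :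
    ∑ i, (sampleProb c ε A S i).toReal ≤ Gᶜ.card + c * Real.log d / ε ^ 2 * (κ * d) := by
  have h1 := sum_genLeverage_le (B := keepRows A S) A G hκ fun x => by
    rw [keepRows_mulVec_dotProduct_self]; exact h x
  rw [← Finset.sum_add_sum_compl G, add_comm]
  refine add_le_add ?_ ?_
  · calc ∑ i ∈ Gᶜ, (sampleProb c ε A S i).toReal ≤ ∑ _i ∈ Gᶜ, (1 : ℝ) :=
          Finset.sum_le_sum fun i _ => (sampleProb_toReal_mem c ε A S i).2
      _ = _ := by simp
  · calc ∑ i ∈ G, (sampleProb c ε A S i).toReal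
        ≤ ∑ i ∈ G, c * Real.log d / ε ^ 2 * (genLeverage (keepRows A S) (A i)).toReal :=
          Finset.sum_le_sum fun i hi => sampleProb_toReal_le hL (h1.1 i hi)
      _ = c * Real.log d / ε ^ 2 * ∑ i ∈ G, (genLeverage (keepRows A S) (A i)).toReal := by
          rw [Finset.mul_sum]
      _ ≤ _ := mul_le_mul_of_nonneg_left h1.2 hL

/-- The quadratic form of the weighted sample with index set `T`. -/
noncomputable def sampleForm (c ε : ℝ) (A : Matrix (Fin n) (Fin d) ℝ) (S T : Finset (Fin n))
    (x : Fin d → ℝ) : ℝ :=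
  ∑ i ∈ T, (((1 / √(sampleProb c ε A S i).toReal) • A i) ⬝ᵥ x) ^ 2

-- The choice of p makes R = ε²/(c log d) admissible in the Chernoff bound, so relative error ε/3
-- gives the exponent c log d/36. The factor 2 counts the two tails. The bound holds for every S; a
-- poor S only inflates the probabilities.
open Classical in
theorem sum_subsetWeight_sampleForm_le (hd : 2 ≤ d) (hc : 0 < c) (hε : 0 < ε) (hε1 : ε ≤ 1)
    (A : Matrix (Fin n) (Fin d) ℝ) (S : Finset (Fin n)) :
    ∑ T ∈ Finset.univ.powerset with ¬ ∀ x,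
        |sampleForm c ε A S T x - ∑ i, (A i ⬝ᵥ x) ^ 2| ≤ ε / 3 * ∑ i, (A i ⬝ᵥ x) ^ 2,
      subsetWeight (fun i => (sampleProb c ε A S i).toReal) Finset.univ T ≤
        2 * (d * Real.exp (-(c * Real.log d / 36))) := by
  have hlog : 0 < Real.log d := Real.log_pos (by exact_mod_cast hd)
  have hL : 0 < c * Real.log d / ε ^ 2 := by positivity
  have : Nonempty (Fin d) := ⟨⟨0, by omega⟩⟩
  set p : Fin n → ℝ := fun i => (sampleProb c ε A S i).toReal with hpdef
  have hp : ∀ i, 0 ≤ p i ∧ p i ≤ 1 := fun i => sampleProb_toReal_mem c ε A S i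
  have hlev : ∀ i, p i < 1 → ∀ x,
      c * Real.log d / ε ^ 2 * (A i ⬝ᵥ x) ^ 2 ≤ p i * ∑ j, (A j ⬝ᵥ x) ^ 2 := fun i hi x =>
    sq_le_sampleProb_mul hL hi x
  have hb : ∀ i x, (((1 / √(p i)) • A i) ⬝ᵥ x) ^ 2 = (p i)⁻¹ * (A i ⬝ᵥ x) ^ 2 := by
    intro i x
    rw [smul_dotProduct, smul_eq_mul, mul_pow, div_pow, Real.sq_sqrt (hp i).1, one_pow, one_div]
  have hq0 : ∀ x, 0 ≤ ∑ i, (A i ⬝ᵥ x) ^ 2 := fun x => Finset.sum_nonneg fun _ _ => sq_nonneg _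
  have hpb : ∀ x, ∑ i, p i * (((1 / √(p i)) • A i) ⬝ᵥ x) ^ 2 = ∑ i, (A i ⬝ᵥ x) ^ 2 := by
    intro x
    refine Finset.sum_congr rfl fun i _ => ?_
    rw [hb]
    rcases eq_or_ne (p i) 0 with h0 | h0
    · have h1 := hlev i (by rw [h0]; exact one_pos) x
      rw [h0, zero_mul] at h1
      have h2 : (A i ⬝ᵥ x) ^ 2 ≤ 0 := by
        by_contra! hcon
        exact absurd (mul_pos hL hcon) (not_lt.2 h1)
      rw [le_antisymm h2 (sq_nonneg _), mul_zero, mul_zero]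
    · rw [← mul_assoc, mul_inv_cancel₀ h0, one_mul]
  obtain ⟨r, hr, hridge⟩ := exists_ridge (k := Fin d) (ι := Finset (Fin n) × Bool)
    (fun j x => (if j.2 then 1 else -1) * (sampleForm c ε A S j.1 x - ∑ i, (A i ⬝ᵥ x) ^ 2))
    (fun _ x => ε / 3 * ∑ i, (A i ⬝ᵥ x) ^ 2)
  have key : ∀ σ : ℝ, |σ| = 1 → ∑ T ∈ Finset.univ.powerset with ∃ x,
      ε / 3 * (∑ i, (A i ⬝ᵥ x) ^ 2 + r * (x ⬝ᵥ x)) <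
        σ * (sampleForm c ε A S T x - ∑ i, (A i ⬝ᵥ x) ^ 2),
      subsetWeight p Finset.univ T ≤ d * Real.exp (-(c * Real.log d / 36)) := by
    intro σ hσ
    have h := Matrix.matrix_chernoff hp Finset.univ (fun i => (1 / √(p i)) • A i)
      (R := (c * Real.log d / ε ^ 2)⁻¹) (r := r) (ε := ε / 3) (σ := σ) (inv_pos.2 hL) hr
      (by positivity) (by linarith) hσ (fun i _ hi x => by
        rw [hpb, hb]
        have h1 := hlev i hi x
        have h2 := mul_nonneg hr.le (dotProduct_self_nonneg_real x)
        rw [le_inv_mul_iff₀ hL]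
        rcases (hp i).1.eq_or_lt with h0 | h0
        · rw [← h0]; simp only [inv_zero, zero_mul, mul_zero]
          linarith [hq0 x]
        · rw [mul_left_comm, inv_mul_le_iff₀ h0]
          nlinarith [mul_nonneg h0.le h2])
    simp only [hpb, Fintype.card_fin] at h
    have e : (ε / 3) ^ 2 / (4 * (c * Real.log d / ε ^ 2)⁻¹) = c * Real.log d / 36 := by
      field_simp
      ring
    rw [e] at h
    exact h
  have h1 := key 1 (by simp)
  have h2 := key (-1) (by simp)
  rw [two_mul]
  refine (sum_filter_le_sum_filter_add_sum_filter (subsetWeight_nonneg hp _) ?_).trans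
    (add_le_add h1 h2)
  · intro T _ hT
    by_contra! hcon
    obtain ⟨hc1, hc2⟩ := hcon
    have hle : ∀ x : Fin d → ℝ, ε / 3 * (∑ i, (A i ⬝ᵥ x) ^ 2 + r * (x ⬝ᵥ x)) ≤
        ε / 3 * ∑ i, (A i ⬝ᵥ x) ^ 2 + r * (x ⬝ᵥ x) := by
      intro x
      have := mul_nonneg hr.le (dotProduct_self_nonneg_real x)
      nlinarith
    have h3 := hridge (T, true) fun x => by simpa using (hc1 x).trans (hle x)
    have h4 := hridge (T, false) fun x => by simpa using (hc2 x).trans (hle x)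
    refine hT fun x => abs_le.2 ⟨?_, ?_⟩
    · have := h4 x
      simp only [Bool.false_eq_true, if_false] at this
      linarith
    · have := h3 x
      simp only [if_true] at this
      linarith

end SampleProb

/-! ### Failure probability for one factor -/

section SingleSample

variable {n d : ℕ}

/-- The outcomes of the sampling of one matrix for which the weighted sample is a spectral
approximation with error `ε / 3` and both the number of rows and the sum of the probabilities are
small. -/
def goodOutcomes (c ε m : ℝ) (A : Matrix (Fin n) (Fin d) ℝ) :
    Set (Finset (Fin n) × Finset (Fin n)) :=
  {ω | (∀ x, |sampleForm c ε A ω.1 ω.2 x - ∑ i, (A i ⬝ᵥ x) ^ 2| ≤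
      ε / 3 * ∑ i, (A i ⬝ᵥ x) ^ 2) ∧ (ω.2.card : ℝ) ≤ 3 * m ∧
    ∑ i, (sampleProb c ε A ω.1 i).toReal ≤ m}

theorem toOuterMeasure_sampleLaw_compl_le {κ c ε m : ℝ} (hκ : 0 < κ) (hc : 36 * κ ≤ c)
    (hd : 2 ≤ d) (hε : 0 < ε) (hε1 : ε ≤ 1)
    (hm : m = (32 * κ + 4 * c) * (d * Real.log d / ε ^ 2)) (A : Matrix (Fin n) (Fin d) ℝ) :
    (sampleLaw c ε A).toOuterMeasure (goodOutcomes c ε m A)ᶜ ≤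
      ENNReal.ofReal (4 * (d * Real.exp (-(κ * Real.log d)))) := by
  classical
  have hd1 : (2 : ℝ) ≤ d := by exact_mod_cast hd
  have hlog : 0 < Real.log d := Real.log_pos (by linarith)
  have hc0 : 0 < c := by linarith
  have : Nonempty (Fin d) := ⟨⟨0, by omega⟩⟩
  set δ : ℝ := Real.exp (-(κ * Real.log d)) with hδ
  have hδ0 : 0 < δ := Real.exp_pos _
  -- This α turns the failure probability of domination into d·d^(-κ) and allows at most 32κ·d·log d
  -- exceptional rows, which is the first part of m.
  have hα : 0 < 1 / (32 * κ * Real.log d) := by positivity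
  obtain ⟨G, hG, hGprob⟩ := exists_dominated_rows (ι := Fin n) A hα
  have hε2 : 1 ≤ 1 / ε ^ 2 := by
    rw [le_div_iff₀ (by positivity), one_mul]
    exact pow_le_one₀ hε.le hε1
  have hX : d * Real.log d ≤ d * Real.log d / ε ^ 2 := by
    rw [div_eq_mul_one_div]
    exact le_mul_of_one_le_right (by positivity) hε2
  have h₁ : (indepSubset (n := n) (fun _ => 1 / 2) (fun _ => by simp)).toOuterMeasure
      {S | ∀ x, ∑ i ∈ G, (A i ⬝ᵥ x) ^ 2 ≤ 4 * ∑ i ∈ S, (A i ⬝ᵥ x) ^ 2}ᶜ ≤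
      ENNReal.ofReal (d * δ) := by
    rw [toOuterMeasure_indepSubset]
    refine ENNReal.ofReal_le_ofReal ?_
    have e : -(1 / (32 * (1 / (32 * κ * Real.log d)))) = -(κ * Real.log d) := by
      field_simp
    rw [e, Fintype.card_fin] at hGprob
    simpa using hGprob
  have h₂ : ∀ S ∈ {S : Finset (Fin n) | ∀ x, ∑ i ∈ G, (A i ⬝ᵥ x) ^ 2 ≤
      4 * ∑ i ∈ S, (A i ⬝ᵥ x) ^ 2},
      ((indepSubset (sampleProb c ε A S) (fun _ => min_le_left _ _)).map
        fun T => (S, T)).toOuterMeasure (goodOutcomes c ε m A)ᶜ ≤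
      ENNReal.ofReal (2 * (d * δ) + δ) := by
    intro S hS
    have hsum : ∑ i, (sampleProb c ε A S i).toReal ≤ m := by
      refine (sum_sampleProb_le (by positivity) (by norm_num) hS).trans ?_
      rw [one_div, inv_mul_le_iff₀ (by positivity), Fintype.card_fin] at hG
      have h1 : c * Real.log d / ε ^ 2 * (4 * d) = 4 * c * (d * Real.log d / ε ^ 2) := by ring
      have h2 := mul_le_mul_of_nonneg_left hX (by positivity : 0 ≤ 32 * κ)
      rw [h1, hm]
      linarith
    have hδm : Real.exp (-m) ≤ δ := by
      refine Real.exp_le_exp.2 (neg_le_neg ?_)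
      have h1 : Real.log d ≤ d * Real.log d / ε ^ 2 :=
        le_trans (le_mul_of_one_le_left hlog.le (by linarith)) hX
      rw [hm]
      exact mul_le_mul (by linarith) h1 hlog.le (by positivity)
    have hδc : Real.exp (-(c * Real.log d / 36)) ≤ δ := by
      refine Real.exp_le_exp.2 (neg_le_neg ?_)
      rw [le_div_iff₀ (by norm_num)]
      have := mul_le_mul_of_nonneg_right hc hlog.le
      linarith
    rw [PMF.toOuterMeasure_map_apply,
      toOuterMeasure_indepSubset (sampleProb c ε A S) (fun _ => min_le_left _ _)]
    refine ENNReal.ofReal_le_ofReal ?_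
    have hp := sampleProb_toReal_mem c ε A S
    refine (sum_filter_le_sum_filter_add_sum_filter
      (Q₁ := fun T => ¬ ∀ x, |sampleForm c ε A S T x - ∑ i, (A i ⬝ᵥ x) ^ 2| ≤
        ε / 3 * ∑ i, (A i ⬝ᵥ x) ^ 2) (Q₂ := fun T => 3 * m < (T.card : ℝ))
      (subsetWeight_nonneg hp _) ?_).trans (add_le_add
        ((sum_subsetWeight_sampleForm_le hd hc0 hε hε1 A S).trans (by gcongr))
        ((sum_subsetWeight_card_gt_le hp _ hsum).trans hδm))
    intro T _ hT
    by_contra! hcon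
    exact hT ⟨hcon.1, hcon.2, hsum⟩
  refine (PMF.toOuterMeasure_bind_le _ _ h₁ h₂).trans ?_
  rw [← ENNReal.ofReal_add (by positivity) (by positivity)]
  refine ENNReal.ofReal_le_ofReal ?_
  -- With δ = d^(-κ), domination fails with probability at most dδ, accuracy 2dδ, and size δ; the
  -- total is at most 4dδ.
  nlinarith

end SingleSample

/-! ### Spectral approximation of Kronecker products -/

section Kronecker

variable {k l : Type*} [Fintype k] [Fintype l]

/-- The factors are replaced one at a time, so each difference telescopes into Kronecker products of
positive semidefinite matrices plus a nonnegative multiple of H₁ ⊗ H₂. -/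
theorem SpectralApprox.kronecker {ε ε' : ℝ} {G₁ H₁ : Matrix k k ℝ} {G₂ H₂ : Matrix l l ℝ}
    (hε' : 0 ≤ ε') (hε'1 : ε' ≤ 1) (hε : 2 * ε' + ε' ^ 2 ≤ ε) (hH₁ : H₁.PosSemidef)
    (hH₂ : H₂.PosSemidef) (hG₂ : G₂.PosSemidef) (h₁ : SpectralApprox ε' G₁ H₁)
    (h₂ : SpectralApprox ε' G₂ H₂) : SpectralApprox ε (G₁ ⊗ₖ G₂) (H₁ ⊗ₖ H₂) := by
  classical
  constructor
  · have e : G₁ ⊗ₖ G₂ - (1 - ε) • (H₁ ⊗ₖ H₂) = (G₁ - (1 - ε') • H₁) ⊗ₖ G₂ +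
        (1 - ε') • (H₁ ⊗ₖ (G₂ - (1 - ε') • H₂)) +
        ((1 - ε') ^ 2 - (1 - ε)) • (H₁ ⊗ₖ H₂) := by
      ext i j
      simp only [Matrix.kroneckerMap_apply, Matrix.sub_apply, Matrix.add_apply, Matrix.smul_apply,
        smul_eq_mul]
      ring
    rw [e]
    exact ((h₁.1.kronecker hG₂).add ((hH₁.kronecker h₂.1).smul (sub_nonneg.2 hε'1))).add
      ((hH₁.kronecker hH₂).smul (by nlinarith))
  · have e : (1 + ε) • (H₁ ⊗ₖ H₂) - G₁ ⊗ₖ G₂ = ((1 + ε') • H₁ - G₁) ⊗ₖ G₂ +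
        (1 + ε') • (H₁ ⊗ₖ ((1 + ε') • H₂ - G₂)) +
        ((1 + ε) - (1 + ε') ^ 2) • (H₁ ⊗ₖ H₂) := by
      ext i j
      simp only [Matrix.kroneckerMap_apply, Matrix.sub_apply, Matrix.add_apply, Matrix.smul_apply,
        smul_eq_mul]
      ring
    rw [e]
    exact ((h₁.2.kronecker hG₂).add ((hH₁.kronecker h₂.2).smul (by positivity))).add
      ((hH₁.kronecker hH₂).smul (by nlinarith))

theorem transpose_mul_self_kronecker {k l m m' : Type*} [Fintype m] [Fintype m'] (A : Matrix m k ℝ)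
    (B : Matrix m' l ℝ) : (A ⊗ₖ B)ᵀ * (A ⊗ₖ B) = (Aᵀ * A) ⊗ₖ (Bᵀ * B) := by
  rw [Matrix.mul_kronecker_mul, Matrix.kroneckerMap_transpose]

theorem spectralApprox_transpose_mul_self {m m' : Type*} [Fintype m] [Fintype m'] {ε : ℝ}
    {B : Matrix m k ℝ} {A : Matrix m' k ℝ}
    (h : ∀ x, |(B *ᵥ x) ⬝ᵥ (B *ᵥ x) - (A *ᵥ x) ⬝ᵥ (A *ᵥ x)| ≤ ε * ((A *ᵥ x) ⬝ᵥ (A *ᵥ x))) :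
    SpectralApprox ε (Bᵀ * B) (Aᵀ * A) := by
  refine ⟨.of_dotProduct_mulVec_nonneg ?_ fun x => ?_, .of_dotProduct_mulVec_nonneg ?_ fun x => ?_⟩
  · rw [Matrix.IsHermitian, Matrix.conjTranspose_eq_transpose_of_trivial]
    simp
  · have := (abs_le.1 (h x)).1
    rw [star_trivial, Matrix.sub_mulVec, Matrix.smul_mulVec, dotProduct_sub, dotProduct_smul,
      smul_eq_mul, dotProduct_mulVec_transpose_mul_self,
      dotProduct_mulVec_transpose_mul_self]
    linarith
  · rw [Matrix.IsHermitian, Matrix.conjTranspose_eq_transpose_of_trivial]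
    simp
  · have := (abs_le.1 (h x)).2
    rw [star_trivial, Matrix.sub_mulVec, Matrix.smul_mulVec, dotProduct_sub, dotProduct_smul,
      smul_eq_mul, dotProduct_mulVec_transpose_mul_self,
      dotProduct_mulVec_transpose_mul_self]
    linarith

end Kronecker

/-! ### Assembly of the two factors -/

theorem spectralApprox_of_mem_goodOutcomes {n d : ℕ} {c ε m : ℝ} {A : Matrix (Fin n) (Fin d) ℝ}
    {ω : Finset (Fin n) × Finset (Fin n)} (h : ω ∈ goodOutcomes c ε m A) :
    SpectralApprox (ε / 3) ((weightedSample c ε A ω)ᵀ * weightedSample c ε A ω) (Aᵀ * A) := by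
  refine spectralApprox_transpose_mul_self fun x => ?_
  have h1 : (weightedSample c ε A ω *ᵥ x) ⬝ᵥ (weightedSample c ε A ω *ᵥ x) =
      sampleForm c ε A ω.1 ω.2 x := by
    rw [sampleForm, ← Finset.sum_coe_sort]
    exact Finset.sum_congr rfl fun i _ => (pow_two _).symm
  have h2 : (A *ᵥ x) ⬝ᵥ (A *ᵥ x) = ∑ i, (A i ⬝ᵥ x) ^ 2 :=
    Finset.sum_congr rfl fun i _ => (pow_two _).symm
  rw [h1, h2]
  exact h.1 x

theorem mainTheorem2 (C : ℝ) (hC : 0 < C) :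
    ∃ c₀ : ℝ, 0 < c₀ ∧ ∀ c : ℝ, c₀ ≤ c → ∃ K : ℝ, 0 < K ∧
      ∀ (n d : ℕ), 2 ≤ d → ∀ (A₁ A₂ : Matrix (Fin n) (Fin d) ℝ) (ε : ℝ), 0 < ε → ε ≤ 1 →
        1 - (d : ℝ) ^ (-C) ≤ ((sampleLaw₂ c ε A₁ A₂).toOuterMeasure {ω |
          SpectralApprox ε
            ((weightedSample c ε A₁ ω.1 ⊗ₖ weightedSample c ε A₂ ω.2)ᵀ *
              (weightedSample c ε A₁ ω.1 ⊗ₖ weightedSample c ε A₂ ω.2))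
            ((A₁ ⊗ₖ A₂)ᵀ * (A₁ ⊗ₖ A₂)) ∧
          (numRows (weightedSample c ε A₁ ω.1 ⊗ₖ weightedSample c ε A₂ ω.2) : ℝ) ≤
            K * ((d : ℝ) ^ 2 * Real.log d ^ 2 / ε ^ 4) ∧
          ∑ i, (sampleProb c ε A₁ ω.1.1 i).toReal ≤ K * (d * Real.log d / ε ^ 2) ∧
          ∑ i, (sampleProb c ε A₂ ω.2.1 i).toReal ≤ K * (d * Real.log d / ε ^ 2)}).toReal := by
  -- One factor fails with probability at most 4d·d^(-κ) = 4d^(-C)/d³, which is at most d^(-C)/2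
  -- because d ≥ 2; the two factors share d^(-C).
  obtain ⟨κ, hκ⟩ : ∃ κ, κ = C + 4 := ⟨_, rfl⟩
  have hκ0 : 0 < κ := by linarith
  refine ⟨36 * κ, by positivity, fun c hc => ?_⟩
  have hc0 : 0 < c := by linarith
  obtain ⟨K₁, hK₁⟩ : ∃ K₁, K₁ = 32 * κ + 4 * c := ⟨_, rfl⟩
  have hK₁1 : 1 ≤ K₁ := by linarith
  -- The product has at most (3m)² rows. As K₁ ≥ 1, the same constant also bounds the sums of
  -- probabilities.
  refine ⟨9 * K₁ ^ 2, by positivity, fun n d hd A₁ A₂ ε hε hε1 => ?_⟩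
  have hd1 : (2 : ℝ) ≤ d := by exact_mod_cast hd
  have hd0 : (0 : ℝ) < d := by linarith
  have hlog : 0 < Real.log d := Real.log_pos (by linarith)
  obtain ⟨m, hm⟩ : ∃ m, m = K₁ * (d * Real.log d / ε ^ 2) := ⟨_, rfl⟩
  have hm0 : 0 < m := by rw [hm]; positivity
  have hmK : m ≤ 9 * K₁ ^ 2 * (d * Real.log d / ε ^ 2) := by
    rw [hm]
    exact mul_le_mul_of_nonneg_right (by nlinarith) (by positivity)
  have hgood := fun A : Matrix (Fin n) (Fin d) ℝ =>
    toOuterMeasure_sampleLaw_compl_le hκ0 hc hd hε hε1 (hK₁ ▸ hm) A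
  have hfail : 4 * (d * Real.exp (-(κ * Real.log d))) ≤ (d : ℝ) ^ (-C) / 2 := by
    have h1 : Real.exp (-(κ * Real.log d)) = (d : ℝ) ^ (-C) / d ^ 4 := by
      rw [Real.rpow_def_of_pos hd0, ← Real.exp_log (pow_pos hd0 4), ← Real.exp_sub, Real.log_pow,
        hκ]
      congr 1
      push_cast
      ring
    have h2 : (8 : ℝ) ≤ d ^ 3 := by
      calc (8 : ℝ) = 2 ^ 3 := by norm_num
        _ ≤ _ := pow_le_pow_left₀ (by norm_num) hd1 3
    have h3 : 0 < (d : ℝ) ^ (-C) := Real.rpow_pos_of_pos hd0 _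
    have h4 : 4 * (d * ((d : ℝ) ^ (-C) / d ^ 4)) = 4 * (d : ℝ) ^ (-C) / d ^ 3 := by
      field_simp
    rw [h1, h4, div_le_div_iff₀ (by positivity) two_pos]
    nlinarith
  refine PMF.one_sub_le_toReal_toOuterMeasure _ (Real.rpow_nonneg hd0.le _) ?_
  refine (PMF.toOuterMeasure_bind_le _ _ (E := goodOutcomes c ε m A₁)
    (δ₂ := ENNReal.ofReal (4 * (d * Real.exp (-(κ * Real.log d))))) (hgood A₁)
    fun ω₁ hω₁ => ?_).trans ?_
  · rw [PMF.toOuterMeasure_map_apply]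
    refine le_trans (MeasureTheory.measure_mono ?_) (hgood A₂)
    intro ω₂ hω₂ hmem
    refine hω₂ ⟨?_, ?_, hω₁.2.2.trans hmK, hmem.2.2.trans hmK⟩
    · rw [transpose_mul_self_kronecker, transpose_mul_self_kronecker]
      have hpsd : ∀ {m : Type} [Fintype m] (M : Matrix m (Fin d) ℝ), (Mᵀ * M).PosSemidef := by
        intro m _ M
        have := Matrix.posSemidef_conjTranspose_mul_self M
        rwa [Matrix.conjTranspose_eq_transpose_of_trivial] at this
      exact SpectralApprox.kronecker (ε' := ε / 3) (by positivity) (by linarith) (by nlinarith)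
        (hpsd _) (hpsd _) (hpsd _) (spectralApprox_of_mem_goodOutcomes hω₁)
        (spectralApprox_of_mem_goodOutcomes hmem)
    · have h1 := mul_le_mul hω₁.2.1 hmem.2.1 (Nat.cast_nonneg _) (by positivity)
      have h2 : (numRows (weightedSample c ε A₁ ω₁ ⊗ₖ weightedSample c ε A₂ ω₂) : ℝ) =
          (ω₁.2.card : ℝ) * ω₂.2.card := by
        simp [numRows]
      rw [h2]
      refine h1.trans (le_of_eq ?_)
      rw [hm]
      ring
  · rw [← ENNReal.ofReal_add (by positivity) (by positivity)]
    exact ENNReal.ofReal_le_ofReal (by linarith)
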